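/- Let $M$ be a smooth $n$-dimensional manifold (all objects are $C^\infty$), $g$ a pseudo-Riemannian metric on $M$, $c$ a symmetric $(0,2)$-tensor field on $M$ and $X$ a vector field on $M$. Let $T^2M$ be the second-order tangent bundle, i.e. the $3n$-dimensional manifold of $2$-jets at $0$ of smooth curves $\mathbb R\to M$; a chart $(x^i)$ of $M$ induces the chart $(x^i,y^i,z^i)$ of $T^2M$ that sends the jet of a curve $F$ to $x^i=F^i(0)$, $y^i=\frac{dF^i}{dt}(0)$, $z^i=\frac12\frac{d^2F^i}{dt^2}(0)$. In induced coordinates (with summation over repeated indices, $\partial_i=\partial/\partial x^i$), the $0$-th, $1$-st and $2$-nd lifts of $X=X^j\partial_j$ to $T^2M$ are $$ {}^{0}X=X^j\tfrac{\partial}{\partial z^j},\qquad {}^{I}X=X^j\tfrac{\partial}{\partial y^j}+y^s\partial_sX^j\tfrac{\partial}{\partial z^j}, $$ $$ {}^{II}X=X^j\tfrac{\partial}{\partial x^j}+y^s\partial_sX^j\tfrac{\partial}{\partial y^j}+\bigl(z^s\partial_sX^j+\tfrac12y^ty^s\partial_t\partial_sX^j\bigr)\tfrac{\partial}{\partial z^j},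 $$ and the deformed $2$-nd lift metric $\overline g={}^{II}g+{}^{0}c$ on $T^2M$ has, with respect to $(x^i,y^i,z^i)$, the matrix $$ \overline g=\begin{pmatrix} z^s\partial_sg_{ij}+\tfrac12y^ty^s\partial_t\partial_sg_{ij}+c_{ij} & y^s\partial_sg_{ij} & g_{ij}\\ y^s\partial_sg_{ij} & g_{ij} & 0\\ g_{ij} & 0 & 0\end{pmatrix}. $$ A (smooth) vector field $Y$ is a Killing vector field for a metric $h$ if $L_Yh=0$, where $L$ denotes the Lie derivative. Then: (i) Each of the lifts ${}^{0}X$ and ${}^{I}X$ is a Killing vector field on $(T^2M,\overline g)$ if and only if $X$ is a Killing vector field on $(M,g)$; in particular, both are Killing if and only if $X$ is. (ii) The lift ${}^{II}X$ is a Killing vector field on $(T^2M,\overline g)$ if and only if $X$ is a Killing vector field on $(M,g)$ and $L_Xc=0$. -/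

import Mathlib

open Set Filter
open scoped Manifold Topology ContDiff

noncomputable section

/-! ### Tensor fields, Lie derivatives and Killing vector fields

All manifolds are smooth, without boundary, modelled on a finite-dimensional real vector space `E`
(for instance `ℝⁿ`). Tangent spaces are Mathlib's `TangentSpace 𝓘(ℝ, E) x`. -/

section Tensors

variable (E : Type*) [NormedAddCommGroup E] [NormedSpace ℝ E]
  (M : Type*) [TopologicalSpace M] [ChartedSpace E M]

/-- A (not necessarily continuous) vector field. -/
abbrev VField : Type _ := (x : M) → TangentSpace 𝓘(ℝ, E) x

/-- A (not necessarily continuous or symmetric) field of bilinear forms on the tangent spaces, that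
is, a `(0,2)`-tensor field. -/
abbrev Tensor02 : Type _ :=
  (x : M) → TangentSpace 𝓘(ℝ, E) x →L[ℝ] TangentSpace 𝓘(ℝ, E) x →L[ℝ] ℝ

variable {E M}

/-- The vector field `X` is of class `C^∞` on the set `U`. -/
def SmoothFieldOn [IsManifold 𝓘(ℝ, E) ∞ M] (X : VField E M) (U : Set M) : Prop :=
  ContMDiffOn 𝓘(ℝ, E) (𝓘(ℝ, E)).tangent ∞
    (fun x ↦ (⟨x, X x⟩ : TangentBundle 𝓘(ℝ, E) M)) U

/-- The function `(L_X h)(Y, Z) = X(h(Y, Z)) - h([X, Y], Z) - h(Y, [X, Z])`. -/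
def lieDerivative (X : VField E M) (h : Tensor02 E M) (Y Z : VField E M) (x : M) : ℝ :=
  let D : ℝ := mfderiv 𝓘(ℝ, E) 𝓘(ℝ, ℝ) (fun p ↦ h p (Y p) (Z p)) x (X x)
  D - h x (VectorField.mlieBracket 𝓘(ℝ, E) X Y x) (Z x)
    - h x (Y x) (VectorField.mlieBracket 𝓘(ℝ, E) X Z x)

/-- `L_X h = 0`: the Lie derivative vanishes on all smooth vector fields `Y`, `Z` defined on open
subsets of the manifold. -/
def LieDerivativeVanishes [IsManifold 𝓘(ℝ, E) ∞ M] (X : VField E M) (h : Tensor02 E M) : Prop :=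
  ∀ U : Set M, IsOpen U → ∀ Y Z : VField E M, SmoothFieldOn Y U → SmoothFieldOn Z U →
    ∀ x ∈ U, lieDerivative X h Y Z x = 0

/-- `X` is a Killing vector field for `h`: a smooth vector field with `L_X h = 0`. -/
def IsKilling [IsManifold 𝓘(ℝ, E) ∞ M] (h : Tensor02 E M) (X : VField E M) : Prop :=
  SmoothFieldOn X univ ∧ LieDerivativeVanishes X h

variable (E M)

/-- A smooth symmetric `(0,2)`-tensor field. -/
structure SymmTensor [IsManifold 𝓘(ℝ, E) ∞ M] where
  /-- the bilinear form on each tangent space -/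
  form : Tensor02 E M
  symm : ∀ (x : M) (v w : TangentSpace 𝓘(ℝ, E) x), form x v w = form x w v
  contMDiff : ContMDiff 𝓘(ℝ, E) (𝓘(ℝ, E).prod 𝓘(ℝ, E →L[ℝ] E →L[ℝ] ℝ)) ∞
    (fun x ↦ Bundle.TotalSpace.mk' (E →L[ℝ] E →L[ℝ] ℝ)
      (E := fun x : M ↦ TangentSpace 𝓘(ℝ, E) x →L[ℝ] TangentSpace 𝓘(ℝ, E) x →L[ℝ] ℝ) x (form x))

/-- A pseudo-Riemannian metric: a smooth symmetric `(0,2)`-tensor field that is nondegenerate at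
every point. -/
structure PseudoRiemannianMetric [IsManifold 𝓘(ℝ, E) ∞ M] extends SymmTensor E M where
  nondegenerate : ∀ (x : M) (v : TangentSpace 𝓘(ℝ, E) x), (∀ w, form x v w = 0) → v = 0

end Tensors

/-! ### The second-order tangent bundle -/

section Jets

variable (E : Type*) [NormedAddCommGroup E] [NormedSpace ℝ E]
  (M : Type*) [TopologicalSpace M] [ChartedSpace E M]

/-- Smooth curves `ℝ → M`. -/
abbrev SmoothCurve : Type _ := C^∞⟮𝓘(ℝ, ℝ), ℝ; 𝓘(ℝ, E), M⟯

variable {E M}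

/-- `(F(0), F'(0), F''(0)/2)` for the expression `F = e ∘ γ` of the curve `γ` in the chart `e`. -/
def curveCoords (e : OpenPartialHomeomorph M E) (γ : SmoothCurve E M) : E × E × E :=
  (e (γ 0), deriv (fun t ↦ e (γ t)) 0, (2⁻¹ : ℝ) • deriv (deriv fun t ↦ e (γ t)) 0)

variable (E M)

/-- Two curves have the same `2`-jet at `0` if they pass through the same point at time `0` and
have there the same first and second derivatives in the preferred chart at this point (equivalently,
in any chart around it, see `curveCoords_change`). -/
def jetSetoid : Setoid (SmoothCurve E M) where
  r γ δ := γ 0 = δ 0 ∧ curveCoords (chartAt E (γ 0)) γ = curveCoords (chartAt E (γ 0)) δ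
  iseqv :=
    { refl := fun _ ↦ ⟨rfl, rfl⟩
      symm := fun {γ δ} h ↦ ⟨h.1.symm, by rw [← h.1]; exact h.2.symm⟩
      trans := fun {γ δ ε} h k ↦
        ⟨h.1.trans k.1, h.2.trans (by have := k.2; rw [← h.1] at this; exact this)⟩ }

/-- The second-order tangent bundle `T²M`: the set of `2`-jets at `0` of smooth curves in `M`. -/
def SecondTangentBundle : Type _ := Quotient (jetSetoid E M)

variable {E M}

namespace SecondTangentBundle

/-- The `2`-jet at `0` of a curve. -/
def jet (γ : SmoothCurve E M) : SecondTangentBundle E M := Quotient.mk (jetSetoid E M) γ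

/-- The projection `T²M → M`. -/
def proj (p : SecondTangentBundle E M) : M :=
  Quotient.lift (s := jetSetoid E M) (fun γ ↦ γ 0) (fun _ _ h ↦ h.1) p

theorem proj_jet (γ : SmoothCurve E M) : (jet γ).proj = γ 0 := rfl

/-- The coordinates `(x, y, z)` on `T²M` induced from the chart `e` of `M`; they are computed with
any representative of the jet, see `inducedCoords_jet`. -/
def inducedCoords (e : OpenPartialHomeomorph M E) (p : SecondTangentBundle E M) : E × E × E :=
  curveCoords e (Quotient.out (s := jetSetoid E M) p)

/-- Second-order prolongation of a map `f` between open subsets of `E`. -/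
def prolong (f : E → E) (v : E × E × E) : E × E × E :=
  (f v.1, fderiv ℝ f v.1 v.2.1,
    fderiv ℝ f v.1 v.2.2 + (2⁻¹ : ℝ) • fderiv ℝ (fderiv ℝ f) v.1 v.2.1 v.2.1)

theorem deriv2_comp {f : E → E} {c : ℝ → E} (hf : ContDiffAt ℝ ∞ f (c 0))
    (hc : ContDiffAt ℝ ∞ c 0) :
    (f (c 0), deriv (fun t ↦ f (c t)) 0, (2⁻¹ : ℝ) • deriv (deriv fun t ↦ f (c t)) 0) =
      prolong f (c 0, deriv c 0, (2⁻¹ : ℝ) • deriv (deriv c) 0) := by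
  have h2' : (2 : ℕ∞ω) ≤ ∞ := ENat.LEInfty.out
  have hf2 : ContDiffAt ℝ 2 f (c 0) := hf.of_le h2'
  have hc2 : ContDiffAt ℝ 2 c 0 := hc.of_le h2'
  have h2 : (2 : ℕ∞ω) ≠ ∞ := by simp
  have key : ∀ᶠ t in 𝓝 (0 : ℝ), HasDerivAt (fun t ↦ f (c t)) (fderiv ℝ f (c t) (deriv c t)) t := by
    filter_upwards [hc2.continuousAt.eventually (hf2.eventually h2), hc2.eventually h2]
      with t h1 h3
    exact (h1.differentiableAt (by simp)).hasFDerivAt.comp_hasDerivAt t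
      (h3.differentiableAt (by simp)).hasDerivAt
  have hd : deriv (fun t ↦ f (c t)) =ᶠ[𝓝 0] fun t ↦ fderiv ℝ f (c t) (deriv c t) :=
    key.mono fun t h ↦ h.deriv
  have hf' : DifferentiableAt ℝ (fderiv ℝ f) (c 0) :=
    (hf2.fderiv_right (m := 1) (by norm_num)).differentiableAt (by simp)
  have hc' : DifferentiableAt ℝ (deriv c) 0 := by
    have h1 : DifferentiableAt ℝ (fderiv ℝ c) 0 :=
      (hc2.fderiv_right (m := 1) (by norm_num)).differentiableAt (by simp)
    exact h1.clm_apply (differentiableAt_const _)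
  have hA : HasDerivAt (fun t ↦ fderiv ℝ f (c t)) (fderiv ℝ (fderiv ℝ f) (c 0) (deriv c 0)) 0 :=
    hf'.hasFDerivAt.comp_hasDerivAt 0 (hc2.differentiableAt (by simp)).hasDerivAt
  have hB := hA.clm_apply hc'.hasDerivAt
  simp only [prolong, Prod.mk.injEq, true_and]
  refine ⟨hd.eq_of_nhds, ?_⟩
  rw [hd.deriv_eq, hB.deriv, smul_add, map_smul, add_comm]

variable [IsManifold 𝓘(ℝ, E) ∞ M]

theorem contDiffAt_curve {e : OpenPartialHomeomorph M E} (he : e ∈ atlas E M)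
    {γ : SmoothCurve E M} (h : γ 0 ∈ e.source) : ContDiffAt ℝ ∞ (fun t ↦ e (γ t)) 0 := by
  have h1 : ContMDiffAt 𝓘(ℝ, E) 𝓘(ℝ, E) ∞ e (γ 0) :=
    contMDiffAt_of_mem_maximalAtlas (IsManifold.subset_maximalAtlas he) h
  exact (h1.comp (0 : ℝ) (γ.contMDiff 0)).contDiffAt

theorem contDiffOn_transition {e e' : OpenPartialHomeomorph M E} (he : e ∈ atlas E M)
    (he' : e' ∈ atlas E M) : ContDiffOn ℝ ∞ (fun x ↦ e' (e.symm x)) (e.symm ≫ₕ e').source := by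
  have h1 : ContMDiffOn 𝓘(ℝ, E) 𝓘(ℝ, E) ∞ e.symm e.target :=
    contMDiffOn_symm_of_mem_maximalAtlas (IsManifold.subset_maximalAtlas he)
  have h2 : ContMDiffOn 𝓘(ℝ, E) 𝓘(ℝ, E) ∞ e' e'.source :=
    contMDiffOn_of_mem_maximalAtlas (IsManifold.subset_maximalAtlas he')
  exact (h2.comp' h1).contDiffOn

/-- Change of induced coordinates, for curves. -/
theorem curveCoords_change {e e' : OpenPartialHomeomorph M E} (he : e ∈ atlas E M)
    (he' : e' ∈ atlas E M) {γ : SmoothCurve E M} (h : γ 0 ∈ e.source) (h' : γ 0 ∈ e'.source) :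
    curveCoords e' γ = prolong (fun x ↦ e' (e.symm x)) (curveCoords e γ) := by
  have hmem : e (γ 0) ∈ (e.symm ≫ₕ e').source := by simp [h, h']
  have hf : ContDiffAt ℝ ∞ (fun x ↦ e' (e.symm x)) (e (γ 0)) :=
    (contDiffOn_transition he he').contDiffAt ((e.symm ≫ₕ e').open_source.mem_nhds hmem)
  have hE : (fun t ↦ e' (γ t)) =ᶠ[𝓝 0] fun t ↦ e' (e.symm (e (γ t))) := by
    have : ∀ᶠ t in 𝓝 (0 : ℝ), γ t ∈ e.source :=
      γ.contMDiff.continuous.continuousAt.eventually (e.open_source.mem_nhds h)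
    filter_upwards [this] with t ht
    rw [e.left_inv ht]
  have := deriv2_comp hf (contDiffAt_curve he h)
  rw [curveCoords, hE.deriv_eq, hE.deriv.deriv_eq, hE.eq_of_nhds]
  exact this

theorem curveCoords_eq {e : OpenPartialHomeomorph M E} (he : e ∈ atlas E M)
    {γ δ : SmoothCurve E M} (h : γ 0 ∈ e.source) (hr : (jetSetoid E M).r γ δ) :
    curveCoords e γ = curveCoords e δ := by
  have h0 := hr.1
  rw [curveCoords_change (chart_mem_atlas E (γ 0)) he (mem_chart_source E (γ 0)) h, hr.2,
    ← curveCoords_change (chart_mem_atlas E (γ 0)) he (h0 ▸ mem_chart_source E (γ 0)) (h0 ▸ h)]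

theorem inducedCoords_jet {e : OpenPartialHomeomorph M E} (he : e ∈ atlas E M)
    {γ : SmoothCurve E M} (h : γ 0 ∈ e.source) :
    inducedCoords e (jet γ) = curveCoords e γ :=
  (curveCoords_eq he h ((jetSetoid E M).symm (Quotient.mk_out (s := jetSetoid E M) γ))).symm

/-- Change of induced coordinates, for jets. -/
theorem inducedCoords_change {e e' : OpenPartialHomeomorph M E} (he : e ∈ atlas E M)
    (he' : e' ∈ atlas E M) {p : SecondTangentBundle E M} (h : p.proj ∈ e.source)
    (h' : p.proj ∈ e'.source) :
    inducedCoords e' p = prolong (fun x ↦ e' (e.symm x)) (inducedCoords e p) := by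
  induction p using Quotient.ind with
  | _ γ =>
    change inducedCoords e' (jet γ) = prolong _ (inducedCoords e (jet γ))
    rw [inducedCoords_jet he h, inducedCoords_jet he' h', curveCoords_change he he' h h']

theorem inducedCoords_fst {e : OpenPartialHomeomorph M E} (he : e ∈ atlas E M)
    {p : SecondTangentBundle E M} (h : p.proj ∈ e.source) : (inducedCoords e p).1 = e p.proj := by
  induction p using Quotient.ind with
  | _ γ =>
    change (inducedCoords e (jet γ)).1 = _
    rw [inducedCoords_jet he h]; rfl

theorem exists_curve {e : OpenPartialHomeomorph M E} (he : e ∈ atlas E M) {v : E × E × E}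
    (hv : v.1 ∈ e.target) :
    ∃ γ : SmoothCurve E M, γ 0 ∈ e.source ∧ curveCoords e γ = v := by
  obtain ⟨x, y, z⟩ := v
  let q : ℝ → E := fun s ↦ x + s • y + s ^ 2 • z
  have hq : Continuous q := by fun_prop
  have hq0 : q 0 = x := by simp [q]
  obtain ⟨r, hr, hball⟩ := Metric.mem_nhds_iff.1
    (hq.continuousAt.preimage_mem_nhds (x := (0 : ℝ)) (by
      rw [hq0]; exact e.open_target.mem_nhds hv))
  let a : ℝ := r / 2
  have ha : 0 < a := by positivity
  let φ : ℝ → ℝ := fun t ↦ a * Real.sin (t / a)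
  have hφ0 : φ 0 = 0 := by simp [φ]
  have hφ : ContDiff ℝ ∞ φ := by fun_prop
  have hφd : ∀ t, HasDerivAt φ (Real.cos (t / a)) t := by
    intro t
    have h := (((hasDerivAt_id t).div_const a).sin).const_mul a
    have e1 : a * (Real.cos (id t / a) * (1 / a)) = Real.cos (t / a) := by
      simp only [id]; field_simp
    exact e1 ▸ h
  have hφd2 : HasDerivAt (fun t ↦ Real.cos (t / a)) 0 0 := by
    have h := ((hasDerivAt_id (0 : ℝ)).div_const a).cos
    simpa using h
  let c : ℝ → E := fun t ↦ q (φ t)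
  have hct : ∀ t, c t ∈ e.target := by
    intro t
    apply hball (a := φ t)
    change a * Real.sin (t / a) ∈ _
    rw [mem_ball_zero_iff, Real.norm_eq_abs, abs_mul, abs_of_pos ha]
    have := Real.abs_sin_le_one (t / a)
    have h2 : a = r / 2 := rfl
    nlinarith
  have hc : ContDiff ℝ ∞ c := by
    have : ContDiff ℝ ∞ q := by fun_prop
    exact this.comp hφ
  have hcm : ContMDiff 𝓘(ℝ, ℝ) 𝓘(ℝ, E) ∞ fun t ↦ e.symm (c t) := by
    intro t
    have h1 : ContMDiffAt 𝓘(ℝ, E) 𝓘(ℝ, E) ∞ e.symm (c t) :=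
      contMDiffAt_symm_of_mem_maximalAtlas (IsManifold.subset_maximalAtlas he) (hct t)
    exact h1.comp t (hc.contMDiff t)
  refine ⟨⟨_, hcm⟩, e.map_target (hct 0), ?_⟩
  have hec : (fun t ↦ e (e.symm (c t))) = c := funext fun t ↦ e.right_inv (hct t)
  have hd : ∀ t, HasDerivAt c (Real.cos (t / a) • y + (2 * φ t * Real.cos (t / a)) • z) t := by
    intro t
    have h1 := ((hφd t).smul_const y).const_add x
    have h2 : HasDerivAt (fun t ↦ φ t ^ 2 • z) ((2 * φ t * Real.cos (t / a)) • z) t := by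
      simpa using ((hφd t).fun_pow 2).smul_const z
    exact h1.fun_add h2
  have hd' : deriv c = fun t ↦ Real.cos (t / a) • y + (2 * φ t * Real.cos (t / a)) • z :=
    funext fun t ↦ (hd t).deriv
  have hd2 : HasDerivAt (deriv c) ((2 : ℝ) • z) 0 := by
    rw [hd']
    have h1 := hφd2.smul_const y
    have h2 := ((((hφd 0).const_mul 2).fun_mul hφd2)).smul_const z
    simpa [hφ0] using h1.fun_add h2
  change (e (e.symm (c 0)), deriv (fun t ↦ e (e.symm (c t))) 0,
    (2⁻¹ : ℝ) • deriv (deriv fun t ↦ e (e.symm (c t))) 0) = (x, y, z)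
  rw [hec, hd2.deriv, e.right_inv (hct 0), hd']
  simp [c, hφ0, hq0, smul_smul]

theorem bijOn_inducedCoords {e : OpenPartialHomeomorph M E} (he : e ∈ atlas E M) :
    BijOn (inducedCoords e) (proj ⁻¹' e.source) (Prod.fst ⁻¹' e.target) := by
  refine ⟨fun p hp ↦ ?_, fun p hp p' hp' h ↦ ?_, fun v hv ↦ ?_⟩
  · simpa only [mem_preimage, inducedCoords_fst he hp] using e.map_source hp
  · have h0 : p.proj = p'.proj := by
      apply e.injOn hp hp'
      rw [← inducedCoords_fst he hp, ← inducedCoords_fst he hp', h]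
    have h1 := inducedCoords_change he (chart_mem_atlas E p.proj) hp (mem_chart_source E _)
    have h2 := inducedCoords_change he (chart_mem_atlas E p.proj) hp'
      (h0 ▸ mem_chart_source E p.proj)
    rw [h, ← h2] at h1
    induction p using Quotient.ind with
    | _ γ =>
      induction p' using Quotient.ind with
      | _ δ =>
        change inducedCoords (chartAt E (γ 0)) (jet γ) = inducedCoords (chartAt E (γ 0)) (jet δ)
          at h1
        have hγδ : γ 0 = δ 0 := h0
        rw [inducedCoords_jet (chart_mem_atlas E _) (mem_chart_source E _),
          inducedCoords_jet (chart_mem_atlas E _) (hγδ ▸ mem_chart_source E (γ 0))] at h1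
        exact Quotient.sound (s := jetSetoid E M) ⟨hγδ, h1⟩
  · obtain ⟨γ, hγ, rfl⟩ := exists_curve he hv
    exact ⟨jet γ, hγ, inducedCoords_jet he hγ⟩

/-- The induced coordinates as a chart `π⁻¹(U) → E × E × E` of `T²M`. -/
def inducedChart (e : OpenPartialHomeomorph M E) (he : e ∈ atlas E M) :
    PartialEquiv (SecondTangentBundle E M) (E × E × E) :=
  haveI : Nonempty (SecondTangentBundle E M) := ⟨jet (ContMDiffMap.const (e.symm 0))⟩
  (bijOn_inducedCoords he).toPartialEquiv _ _ _

theorem inducedChart_apply {e : OpenPartialHomeomorph M E} (he : e ∈ atlas E M)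
    (p : SecondTangentBundle E M) : inducedChart e he p = inducedCoords e p := rfl

theorem proj_inducedChart_symm {e : OpenPartialHomeomorph M E} (he : e ∈ atlas E M)
    {v : E × E × E} (hv : v.1 ∈ e.target) : ((inducedChart e he).symm v).proj = e.symm v.1 := by
  have h1 : ((inducedChart e he).symm v).proj ∈ e.source := (inducedChart e he).map_target hv
  have h2 : inducedCoords e ((inducedChart e he).symm v) = v := (inducedChart e he).right_inv hv
  rw [← e.left_inv h1, ← inducedCoords_fst he h1, h2]

theorem inducedChart_trans_source {e e' : OpenPartialHomeomorph M E} (he : e ∈ atlas E M)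
    (he' : e' ∈ atlas E M) :
    ((inducedChart e he).symm.trans (inducedChart e' he')).source =
      Prod.fst ⁻¹' (e.symm ≫ₕ e').source := by
  ext v
  rw [PartialEquiv.trans_source]
  constructor
  · rintro ⟨hv, hv'⟩
    have hv : v.1 ∈ e.target := hv
    have hv' : ((inducedChart e he).symm v).proj ∈ e'.source := hv'
    rw [proj_inducedChart_symm he hv] at hv'
    simp [hv, hv']
  · intro hv
    have hv : v.1 ∈ e.target ∧ e.symm v.1 ∈ e'.source := by simpa using hv
    refine ⟨hv.1, ?_⟩
    change ((inducedChart e he).symm v).proj ∈ e'.source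
    rw [proj_inducedChart_symm he hv.1]
    exact hv.2

theorem inducedChart_trans_apply {e e' : OpenPartialHomeomorph M E} (he : e ∈ atlas E M)
    (he' : e' ∈ atlas E M) {v : E × E × E} (hv : v.1 ∈ (e.symm ≫ₕ e').source) :
    inducedChart e' he' ((inducedChart e he).symm v) = prolong (fun x ↦ e' (e.symm x)) v := by
  have hv : v.1 ∈ e.target ∧ e.symm v.1 ∈ e'.source := by simpa using hv
  have h1 : ((inducedChart e he).symm v).proj ∈ e.source := (inducedChart e he).map_target hv.1
  have h2 : inducedCoords e ((inducedChart e he).symm v) = v := (inducedChart e he).right_inv hv.1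
  rw [inducedChart_apply, inducedCoords_change he he' h1
    (by rw [proj_inducedChart_symm he hv.1]; exact hv.2), h2]

theorem contDiffOn_prolong {f : E → E} {s : Set E} (hs : IsOpen s) (hf : ContDiffOn ℝ ∞ f s) :
    ContDiffOn ℝ ∞ (prolong f) (Prod.fst ⁻¹' s) := by
  have h1 : ContDiffOn ℝ ∞ (fderiv ℝ f) s := hf.fderiv_of_isOpen hs (by simp)
  have h2 : ContDiffOn ℝ ∞ (fderiv ℝ (fderiv ℝ f)) s := h1.fderiv_of_isOpen hs (by simp)
  have hp : ContDiffOn ℝ ∞ (Prod.fst : E × E × E → E) (Prod.fst ⁻¹' s) := contDiffOn_fst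
  have hm : MapsTo (Prod.fst : E × E × E → E) (Prod.fst ⁻¹' s) s := fun _ h ↦ h
  have k0 := hf.comp hp hm
  have k1 := h1.comp hp hm
  have k2 := h2.comp hp hm
  have hy : ContDiffOn ℝ ∞ (fun v : E × E × E ↦ v.2.1) (Prod.fst ⁻¹' s) := by fun_prop
  have hz : ContDiffOn ℝ ∞ (fun v : E × E × E ↦ v.2.2) (Prod.fst ⁻¹' s) := by fun_prop
  exact k0.prodMk ((k1.clm_apply hy).prodMk
    ((k1.clm_apply hz).add (contDiffOn_const.smul ((k2.clm_apply hy).clm_apply hy))))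

theorem contDiffOn_inducedChart_trans {e e' : OpenPartialHomeomorph M E} (he : e ∈ atlas E M)
    (he' : e' ∈ atlas E M) :
    ContDiffOn ℝ ∞ ((inducedChart e he).symm.trans (inducedChart e' he'))
      ((inducedChart e he).symm.trans (inducedChart e' he')).source := by
  rw [inducedChart_trans_source]
  exact (contDiffOn_prolong (e.symm ≫ₕ e').open_source (contDiffOn_transition he he')).congr
    fun v hv ↦ inducedChart_trans_apply he he' hv

variable (E M) in
/-- The atlas of induced charts on `T²M`. -/
def core : ChartedSpaceCore (E × E × E) (SecondTangentBundle E M) where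
  atlas := {φ | ∃ (e : OpenPartialHomeomorph M E) (he : e ∈ atlas E M), φ = inducedChart e he}
  chartAt p := inducedChart (chartAt E p.proj) (chart_mem_atlas E p.proj)
  mem_chart_source p := mem_chart_source E p.proj
  chart_mem_atlas p := ⟨_, _, rfl⟩
  open_source := by
    rintro _ _ ⟨e, he, rfl⟩ ⟨e', he', rfl⟩
    rw [inducedChart_trans_source]
    exact (e.symm ≫ₕ e').open_source.preimage continuous_fst
  continuousOn_toFun := by
    rintro _ _ ⟨e, he, rfl⟩ ⟨e', he', rfl⟩
    exact (contDiffOn_inducedChart_trans he he').continuousOn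

instance : TopologicalSpace (SecondTangentBundle E M) := (core E M).toTopologicalSpace

instance : ChartedSpace (E × E × E) (SecondTangentBundle E M) := (core E M).toChartedSpace

/-- The preferred chart at `p` is induced from the preferred chart of `M` at `π(p)`. -/
theorem chartAt_apply (p q : SecondTangentBundle E M) :
    chartAt (E × E × E) p q = inducedCoords (chartAt E p.proj) q := rfl

instance : IsManifold 𝓘(ℝ, E × E × E) ∞ (SecondTangentBundle E M) := by
  apply isManifold_of_contDiffOn
  rintro φ φ' hφ hφ'
  obtain ⟨_, ⟨e, he, rfl⟩, rfl⟩ : ∃ (e₁ : _) (h : e₁ ∈ (core E M).atlas),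
      φ = (core E M).openPartialHomeomorph e₁ h := by
    obtain ⟨_, ⟨e₁, rfl⟩, h⟩ := hφ
    obtain ⟨_, ⟨h₁, rfl⟩, h₂⟩ := h
    exact ⟨e₁, h₁, h₂⟩
  obtain ⟨_, ⟨e', he', rfl⟩, rfl⟩ : ∃ (e₁ : _) (h : e₁ ∈ (core E M).atlas),
      φ' = (core E M).openPartialHomeomorph e₁ h := by
    obtain ⟨_, ⟨e₁, rfl⟩, h⟩ := hφ'
    obtain ⟨_, ⟨h₁, rfl⟩, h₂⟩ := h
    exact ⟨e₁, h₁, h₂⟩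
  simp only [modelWithCornersSelf_coe, modelWithCornersSelf_coe_symm, Function.id_comp,
    Function.comp_id, preimage_id, range_id, inter_univ]
  exact contDiffOn_inducedChart_trans he he'

end SecondTangentBundle

end Jets

/-! ### Lifts to the second-order tangent bundle

The tangent space of `T²M` at `p` is identified with `E × E × E` through the preferred chart at `p`,
which is the induced chart of the preferred chart of `M` at `π(p)`; likewise the tangent space of
`M` at `π(p)` is identified with `E`. All coordinate expressions below are taken in these charts. -/

section Lifts

variable {E : Type*} [NormedAddCommGroup E] [NormedSpace ℝ E]
  {M : Type*} [TopologicalSpace M] [ChartedSpace E M]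

/-- The components `u ↦ (Xʲ(u))` of the vector field `X` in the preferred chart at `x`. -/
def localField (X : VField E M) (x : M) : E → E :=
  VectorField.mpullback 𝓘(ℝ, E) 𝓘(ℝ, E) (chartAt E x).symm X

/-- The components `u ↦ (hᵢⱼ(u))` of the tensor field `h` in the preferred chart at `x`. -/
def localTensor (h : Tensor02 E M) (x : M) : E → E →L[ℝ] E →L[ℝ] ℝ := fun u ↦
  let A : E →L[ℝ] E := mfderiv 𝓘(ℝ, E) 𝓘(ℝ, E) (chartAt E x).symm u
  let B : E →L[ℝ] E →L[ℝ] ℝ := h ((chartAt E x).symm u)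
  B.bilinearComp A A

variable [IsManifold 𝓘(ℝ, E) ∞ M]

open SecondTangentBundle

/-- The induced coordinates of `p` itself, in the preferred chart at `p`. -/
def ownCoords (p : SecondTangentBundle E M) : E × E × E := inducedCoords (chartAt E p.proj) p

/-- The `0`-th lift `Xʲ ∂/∂zʲ` of a vector field. -/
def lift0 (X : VField E M) : VField (E × E × E) (SecondTangentBundle E M) := fun p ↦
  let x := (ownCoords p).1
  let ξ := localField X p.proj
  ((0, 0, ξ x) : E × E × E)

/-- The `1`-st lift `Xʲ ∂/∂yʲ + yˢ ∂ₛXʲ ∂/∂zʲ` of a vector field. -/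
def lift1 (X : VField E M) : VField (E × E × E) (SecondTangentBundle E M) := fun p ↦
  let x := (ownCoords p).1
  let y := (ownCoords p).2.1
  let ξ := localField X p.proj
  ((0, ξ x, fderiv ℝ ξ x y) : E × E × E)

/-- The `2`-nd lift `Xʲ ∂/∂xʲ + yˢ ∂ₛXʲ ∂/∂yʲ + (zˢ ∂ₛXʲ + ½ yᵗ yˢ ∂ₜ∂ₛXʲ) ∂/∂zʲ` of a vector
field. -/
def lift2 (X : VField E M) : VField (E × E × E) (SecondTangentBundle E M) := fun p ↦
  let x := (ownCoords p).1
  let y := (ownCoords p).2.1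
  let z := (ownCoords p).2.2
  let ξ := localField X p.proj
  ((ξ x, fderiv ℝ ξ x y,
    fderiv ℝ ξ x z + (2⁻¹ : ℝ) • fderiv ℝ (fun u ↦ fderiv ℝ ξ u y) x y) : E × E × E)

/-- The bilinear form on `E × E × E` with block matrix `((P, Q, R), (Q, R, 0), (R, 0, 0))`. -/
def blockForm (P Q R : E →L[ℝ] E →L[ℝ] ℝ) : (E × E × E) →L[ℝ] (E × E × E) →L[ℝ] ℝ :=
  let a : E × E × E →L[ℝ] E := ContinuousLinearMap.fst ℝ E (E × E)
  let b : E × E × E →L[ℝ] E :=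
    (ContinuousLinearMap.fst ℝ E E).comp (ContinuousLinearMap.snd ℝ E (E × E))
  let c : E × E × E →L[ℝ] E :=
    (ContinuousLinearMap.snd ℝ E E).comp (ContinuousLinearMap.snd ℝ E (E × E))
  P.bilinearComp a a + Q.bilinearComp a b + R.bilinearComp a c
    + Q.bilinearComp b a + R.bilinearComp b b + R.bilinearComp c a

/-- The `0`-th lift of a `(0,2)`-tensor field, with block matrix
`((hᵢⱼ, 0, 0), (0, 0, 0), (0, 0, 0))`. -/
def tensorLift0 (h : Tensor02 E M) : Tensor02 (E × E × E) (SecondTangentBundle E M) := fun p ↦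
  let x := (ownCoords p).1
  let η := localTensor h p.proj
  blockForm (η x) 0 0

/-- The `2`-nd lift of a `(0,2)`-tensor field, with block matrix
`((zˢ∂ₛhᵢⱼ + ½yᵗyˢ∂ₜ∂ₛhᵢⱼ, yˢ∂ₛhᵢⱼ, hᵢⱼ), (yˢ∂ₛhᵢⱼ, hᵢⱼ, 0), (hᵢⱼ, 0, 0))`. -/
def tensorLift2 (h : Tensor02 E M) : Tensor02 (E × E × E) (SecondTangentBundle E M) := fun p ↦
  let x := (ownCoords p).1
  let y := (ownCoords p).2.1
  let z := (ownCoords p).2.2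
  let η := localTensor h p.proj
  blockForm (fderiv ℝ η x z + (2⁻¹ : ℝ) • fderiv ℝ (fun u ↦ fderiv ℝ η u y) x y)
    (fderiv ℝ η x y) (η x)

/-- The deformed `2`-nd lift metric: the `2`-nd lift of `g` plus the `0`-th lift of `c`. -/
def deformedLiftMetric (g c : Tensor02 E M) : Tensor02 (E × E × E) (SecondTangentBundle E M) :=
  fun p ↦ tensorLift2 g p + tensorLift0 c p

end Lifts

end

/-! The lifts are Taylor coefficients. If `v = (x, y, z)` stands for the curve `x + t y + t² z`,
then the value, `jet1` and `jet2` of a map are the coefficients of `1`, `t`, `t²` of that map along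
the curve. The lift ᴵᴵX lists the three coefficients of the components of X; ᴵX and ⁰X list the same
coefficients delayed by one and two places; the blocks of ᴵᴵg are the coefficients of the components
of g. Taking coefficients obeys the product rule (`jet1_clm_apply`, `jet2_clm_apply`), the chain
rule (`jet1_comp`, `jet2_comp`) and commutes with differentiation (`fderiv_jet1_apply`,
`fderiv_jet2_apply`).

Since the Lie derivative is built from products and derivatives, it commutes with lifting. In an
induced chart, with ḡ the deformed metric, `coordLie_zerothLift`, `coordLie_firstLift` and
`coordLie_secondLift` say that L ḡ along ⁰X is ⁰(L_X g), along ᴵX it is ᴵ(L_X g), and along ᴵᴵX it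
is ᴵᴵ(L_X g) + ⁰(L_X c). The first two contain no c, because ⁰c involves only x and dx, which ⁰X and
ᴵX do not move. If L_X g vanishes on an open set, so do its Taylor coefficients. Conversely, L_X g
appears undifferentiated as a block in each of the three matrices; in the last one, once L_X g = 0,
only the block L_X c is left.

It remains to pass between manifolds and coordinates. `lieDerivativeVanishes_iff_coordLie` turns L_X
h = 0 into its coordinate form in every chart. The lifts are defined at each point of T²M by means
of the preferred chart of that point, so one must also know that the same formulas hold throughout a
single induced chart: this is the covariance of the lifts under changes of chart, again the chain
and product rules for Taylor coefficients (`localField_lift0`, `localField_lift1`,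
`localField_lift2`, `localTensor_deformedLiftMetric`). -/

noncomputable section

/-! ### Calculus of second-order Taylor coefficients -/

section JetCalculus

variable {E F G : Type*} [NormedAddCommGroup E] [NormedSpace ℝ E] [NormedAddCommGroup F]
  [NormedSpace ℝ F] [NormedAddCommGroup G] [NormedSpace ℝ G]

/-- The coefficient of `t` in the expansion of `f (x + t y + t² z)`, where `v = (x, y, z)`. -/
def jet1 (f : E → F) (v : E × E × E) : F := fderiv ℝ f v.1 v.2.1

/-- The coefficient of `t²` in the expansion of `f (x + t y + t² z)`, where `v = (x, y, z)`. -/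
def jet2 (f : E → F) (v : E × E × E) : F :=
  fderiv ℝ f v.1 v.2.2 + (2⁻¹ : ℝ) • fderiv ℝ (fderiv ℝ f) v.1 v.2.1 v.2.1

theorem prolong_eq_jets (f : E → E) :
    SecondTangentBundle.prolong f = fun v ↦ (f v.1, jet1 f v, jet2 f v) := rfl

theorem jet1_congr {f g : E → F} {v : E × E × E} (h : f =ᶠ[𝓝 v.1] g) : jet1 f v = jet1 g v := by
  rw [jet1, jet1, h.fderiv_eq]

theorem jet2_congr {f g : E → F} {v : E × E × E} (h : f =ᶠ[𝓝 v.1] g) : jet2 f v = jet2 g v := by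
  rw [jet2, jet2, h.fderiv_eq, h.fderiv.fderiv_eq]

theorem ContDiffAt.differentiableAt_of_infty {f : E → F} {x : E} (hf : ContDiffAt ℝ ∞ f x) :
    DifferentiableAt ℝ f x := hf.differentiableAt (by simp)

theorem ContDiffAt.fderiv_infty {f : E → F} {x : E} (hf : ContDiffAt ℝ ∞ f x) :
    ContDiffAt ℝ ∞ (fderiv ℝ f) x := hf.fderiv_right (m := ∞) (by simp)

theorem ContDiffAt.eventually_differentiableAt {f : E → F} {x : E} (hf : ContDiffAt ℝ ∞ f x) :
    ∀ᶠ u in 𝓝 x, DifferentiableAt ℝ f u := by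
  have h : ContDiffAt ℝ 1 f x := hf.of_le (by simp)
  filter_upwards [h.eventually (by simp)] with u hu
  exact hu.differentiableAt (by simp)

theorem fderiv_fderiv_apply {f : E → F} {x : E} (hf : ContDiffAt ℝ ∞ f x) (a b : E) :
    fderiv ℝ (fun u ↦ fderiv ℝ f u b) x a = fderiv ℝ (fderiv ℝ f) x a b := by
  rw [fderiv_clm_apply hf.fderiv_infty.differentiableAt_of_infty (differentiableAt_const b)]
  simp

theorem fderiv_fderiv_symm {f : E → F} {x : E} (hf : ContDiffAt ℝ ∞ f x) (a b : E) :
    fderiv ℝ (fderiv ℝ f) x a b = fderiv ℝ (fderiv ℝ f) x b a :=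
  (hf.isSymmSndFDerivAt
    (by rw [minSmoothness_of_isRCLikeNormedField]; exact ENat.LEInfty.out)).eq a b

theorem contDiffAt_jet1 {f : E → F} {v : E × E × E} (hf : ContDiffAt ℝ ∞ f v.1) :
    ContDiffAt ℝ ∞ (jet1 f) v := by
  have h : ContDiffAt ℝ ∞ (fun v : E × E × E ↦ fderiv ℝ f v.1) v :=
    hf.fderiv_infty.comp v contDiffAt_fst
  exact h.clm_apply (by fun_prop)

theorem contDiffAt_jet2 {f : E → F} {v : E × E × E} (hf : ContDiffAt ℝ ∞ f v.1) :
    ContDiffAt ℝ ∞ (jet2 f) v := by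
  have h : ContDiffAt ℝ ∞ (fun v : E × E × E ↦ fderiv ℝ f v.1) v :=
    hf.fderiv_infty.comp v contDiffAt_fst
  have h' : ContDiffAt ℝ ∞ (fun v : E × E × E ↦ fderiv ℝ (fderiv ℝ f) v.1) v :=
    hf.fderiv_infty.fderiv_infty.comp v contDiffAt_fst
  exact (h.clm_apply (by fun_prop)).add
    (contDiffAt_const.smul ((h'.clm_apply (by fun_prop)).clm_apply (by fun_prop)))

theorem fderiv_comp_fst_apply {f : E → F} {v : E × E × E} (hf : ContDiffAt ℝ ∞ f v.1)
    (w : E × E × E) : fderiv ℝ (fun v : E × E × E ↦ f v.1) v w = fderiv ℝ f v.1 w.1 := by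
  have := (hf.differentiableAt_of_infty.hasFDerivAt.comp v hasFDerivAt_fst).fderiv
  change fderiv ℝ (fun v : E × E × E ↦ f v.1) v = _ at this
  rw [this]; rfl

/-- Varying the curve in direction `w` changes f by Df applied to `w.1 + t w.2.1 + t² w.2.2`, to
first order; the right side is the coefficient of t in that product. Symmetry of D²f lets `y` be the
direction in which Df is expanded. -/
theorem fderiv_jet1_apply {f : E → F} {v : E × E × E} (hf : ContDiffAt ℝ ∞ f v.1)
    (w : E × E × E) :
    fderiv ℝ (jet1 f) v w = jet1 (fderiv ℝ f) v w.1 + fderiv ℝ f v.1 w.2.1 := by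
  have h : ContDiffAt ℝ ∞ (fun v : E × E × E ↦ fderiv ℝ f v.1) v :=
    hf.fderiv_infty.comp v contDiffAt_fst
  have hy : fderiv ℝ (fun v : E × E × E ↦ v.2.1) v w = w.2.1 := by
    rw [(hasFDerivAt_snd.fst (𝕜 := ℝ)).fderiv]; rfl
  unfold jet1
  rw [fderiv_clm_apply h.differentiableAt_of_infty (by fun_prop)]
  simp only [add_apply, ContinuousLinearMap.comp_apply,
    ContinuousLinearMap.flip_apply, hy]
  rw [fderiv_comp_fst_apply hf.fderiv_infty, fderiv_fderiv_symm hf, add_comm]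

/-- The coefficient of t² in the same product. The factor ½ disappears from the `w.2.1` term because
D²f(y, y) is differentiated in both of its arguments. -/
theorem fderiv_jet2_apply {f : E → F} {v : E × E × E} (hf : ContDiffAt ℝ ∞ f v.1)
    (w : E × E × E) :
    fderiv ℝ (jet2 f) v w =
      jet2 (fderiv ℝ f) v w.1 + jet1 (fderiv ℝ f) v w.2.1 + fderiv ℝ f v.1 w.2.2 := by
  have hf1 := hf.fderiv_infty
  have hf2 := hf1.fderiv_infty
  have h : ContDiffAt ℝ ∞ (fun v : E × E × E ↦ fderiv ℝ f v.1) v :=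
    hf1.comp v contDiffAt_fst
  have h' : ContDiffAt ℝ ∞ (fun v : E × E × E ↦ fderiv ℝ (fderiv ℝ f) v.1) v :=
    hf2.comp v contDiffAt_fst
  have hy : fderiv ℝ (fun v : E × E × E ↦ v.2.1) v w = w.2.1 := by
    rw [(hasFDerivAt_snd.fst (𝕜 := ℝ)).fderiv]; rfl
  have hz : fderiv ℝ (fun v : E × E × E ↦ v.2.2) v w = w.2.2 := by
    rw [(hasFDerivAt_snd.snd (𝕜 := ℝ)).fderiv]; rfl
  have h'd := h'.differentiableAt_of_infty
  have hy' : DifferentiableAt ℝ (fun v : E × E × E ↦ v.2.1) v := by fun_prop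
  have hz' : DifferentiableAt ℝ (fun v : E × E × E ↦ v.2.2) v := by fun_prop
  have hd1 : DifferentiableAt ℝ (fun v : E × E × E ↦ fderiv ℝ f v.1 v.2.2) v :=
    h.differentiableAt_of_infty.clm_apply hz'
  have hd2 : DifferentiableAt ℝ (fun v : E × E × E ↦ fderiv ℝ (fderiv ℝ f) v.1 v.2.1) v :=
    h'd.clm_apply hy'
  have hd3 := hd2.clm_apply hy'
  unfold jet2
  rw [fderiv_fun_add hd1 (hd3.fun_const_smul _), fderiv_fun_const_smul hd3,
    fderiv_clm_apply h.differentiableAt_of_infty hz', fderiv_clm_apply hd2 hy',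
    fderiv_clm_apply h'd hy']
  simp only [add_apply, ContinuousLinearMap.comp_apply,
    ContinuousLinearMap.flip_apply, smul_apply, hy, hz]
  rw [fderiv_comp_fst_apply hf1, fderiv_comp_fst_apply hf2, fderiv_fderiv_symm hf w.1,
    fderiv_fderiv_symm hf1 w.1, fderiv_fderiv_symm hf v.2.1 w.2.1]
  -- Symmetry of D³f in its last two arguments: the symmetry of D²f holds at all nearby points, so
  -- it can be differentiated.
  have h3 : fderiv ℝ (fderiv ℝ (fderiv ℝ f)) v.1 v.2.1 w.1 v.2.1 =
      fderiv ℝ (fderiv ℝ (fderiv ℝ f)) v.1 v.2.1 v.2.1 w.1 := by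
    have key : (fun u ↦ fderiv ℝ (fderiv ℝ f) u w.1 v.2.1) =ᶠ[𝓝 v.1]
        fun u ↦ fderiv ℝ (fderiv ℝ f) u v.2.1 w.1 := by
      have h2 : ContDiffAt ℝ 2 f v.1 := hf.of_le ENat.LEInfty.out
      filter_upwards [h2.eventually (by simp)] with u hu
      exact (hu.isSymmSndFDerivAt (by simp [minSmoothness_of_isRCLikeNormedField])).eq _ _
    have e (a b : E) : fderiv ℝ (fun u ↦ fderiv ℝ (fderiv ℝ f) u a b) v.1 v.2.1 =
        fderiv ℝ (fderiv ℝ (fderiv ℝ f)) v.1 v.2.1 a b := by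
      have hA := hf2.differentiableAt_of_infty
      rw [fderiv_clm_apply (hA.clm_apply (differentiableAt_const a)) (differentiableAt_const b),
        fderiv_clm_apply hA (differentiableAt_const a)]
      simp
    rw [← e, key.fderiv_eq, e]
  rw [h3]
  unfold jet1
  rw [fderiv_fderiv_symm hf v.2.1 w.2.1]
  module

theorem jet1_clm_apply {A : E → F →L[ℝ] G} {f : E → F} {v : E × E × E}
    (hA : ContDiffAt ℝ ∞ A v.1) (hf : ContDiffAt ℝ ∞ f v.1) :
    jet1 (fun u ↦ A u (f u)) v = A v.1 (jet1 f v) + jet1 A v (f v.1) := by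
  rw [jet1, fderiv_clm_apply hA.differentiableAt_of_infty hf.differentiableAt_of_infty]
  rfl

/-- On the diagonal the two mixed terms of the Leibniz rule coincide; the resulting 2 cancels the ½
in `jet2`. -/
theorem fderiv_fderiv_clm_apply {A : E → F →L[ℝ] G} {f : E → F} {x : E}
    (hA : ContDiffAt ℝ ∞ A x) (hf : ContDiffAt ℝ ∞ f x) (a : E) :
    fderiv ℝ (fderiv ℝ fun u ↦ A u (f u)) x a a =
      A x (fderiv ℝ (fderiv ℝ f) x a a) + (2 : ℝ) • fderiv ℝ A x a (fderiv ℝ f x a) +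
        fderiv ℝ (fderiv ℝ A) x a a (f x) := by
  rw [← fderiv_fderiv_apply (hA.clm_apply hf)]
  have key : (fun u ↦ fderiv ℝ (fun u ↦ A u (f u)) u a) =ᶠ[𝓝 x]
      fun u ↦ A u (fderiv ℝ f u a) + fderiv ℝ A u a (f u) := by
    filter_upwards [hA.eventually_differentiableAt, hf.eventually_differentiableAt] with u h1 h2
    rw [fderiv_clm_apply h1 h2]; rfl
  have hAd := hA.differentiableAt_of_infty
  have hfd := hf.differentiableAt_of_infty
  have hA1 := hA.fderiv_infty.differentiableAt_of_infty.clm_apply (differentiableAt_const a)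
  have hf1 := hf.fderiv_infty.differentiableAt_of_infty.clm_apply (differentiableAt_const a)
  rw [key.fderiv_eq, fderiv_fun_add (hAd.clm_apply hf1) (hA1.clm_apply hfd),
    fderiv_clm_apply hAd hf1, fderiv_clm_apply hA1 hfd]
  simp only [add_apply, ContinuousLinearMap.comp_apply,
    ContinuousLinearMap.flip_apply, fderiv_fderiv_apply hA, fderiv_fderiv_apply hf]
  module

/-- Cauchy product of the two Taylor expansions, in degree 2. -/
theorem jet2_clm_apply {A : E → F →L[ℝ] G} {f : E → F} {v : E × E × E}
    (hA : ContDiffAt ℝ ∞ A v.1) (hf : ContDiffAt ℝ ∞ f v.1) :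
    jet2 (fun u ↦ A u (f u)) v =
      A v.1 (jet2 f v) + jet1 A v (jet1 f v) + jet2 A v (f v.1) := by
  rw [jet2, fderiv_fderiv_clm_apply hA hf,
    fderiv_clm_apply hA.differentiableAt_of_infty hf.differentiableAt_of_infty]
  simp only [jet1, jet2, add_apply, ContinuousLinearMap.comp_apply,
    ContinuousLinearMap.flip_apply, smul_apply, map_add, map_smul]
  module

theorem jet1_comp {f : E → F} {φ : E → E} {v : E × E × E}
    (hf : ContDiffAt ℝ ∞ f (φ v.1)) (hφ : ContDiffAt ℝ ∞ φ v.1) :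
    jet1 (fun u ↦ f (φ u)) v = jet1 f (SecondTangentBundle.prolong φ v) := by
  have := fderiv_comp v.1 hf.differentiableAt_of_infty hφ.differentiableAt_of_infty
  change fderiv ℝ (fun u ↦ f (φ u)) v.1 = _ at this
  rw [jet1, this]; rfl

/-- `prolong φ v` is the 2-jet of the image curve, so both sides expand f along the same curve up to
order t². -/
theorem jet2_comp {f : E → F} {φ : E → E} {v : E × E × E}
    (hf : ContDiffAt ℝ ∞ f (φ v.1)) (hφ : ContDiffAt ℝ ∞ φ v.1) :
    jet2 (fun u ↦ f (φ u)) v = jet2 f (SecondTangentBundle.prolong φ v) := by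
  have e1 {u : E} (h1 : DifferentiableAt ℝ f (φ u)) (h2 : DifferentiableAt ℝ φ u) (a : E) :
      fderiv ℝ (fun u ↦ f (φ u)) u a = fderiv ℝ f (φ u) (fderiv ℝ φ u a) := by
    have := fderiv_comp u h1 h2
    change fderiv ℝ (fun u ↦ f (φ u)) u = _ at this
    rw [this]; rfl
  have hA : ContDiffAt ℝ ∞ (fun u ↦ fderiv ℝ f (φ u)) v.1 := hf.fderiv_infty.comp v.1 hφ
  have e2 : fderiv ℝ (fderiv ℝ fun u ↦ f (φ u)) v.1 v.2.1 v.2.1 =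
      fderiv ℝ f (φ v.1) (fderiv ℝ (fderiv ℝ φ) v.1 v.2.1 v.2.1) +
        fderiv ℝ (fderiv ℝ f) (φ v.1) (fderiv ℝ φ v.1 v.2.1) (fderiv ℝ φ v.1 v.2.1) := by
    have hc : ContDiffAt ℝ ∞ (fun u ↦ f (φ u)) v.1 := hf.comp v.1 hφ
    rw [← fderiv_fderiv_apply hc]
    have key : (fun u ↦ fderiv ℝ (fun u ↦ f (φ u)) u v.2.1) =ᶠ[𝓝 v.1]
        fun u ↦ fderiv ℝ f (φ u) (fderiv ℝ φ u v.2.1) := by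
      filter_upwards [hφ.continuousAt.eventually hf.eventually_differentiableAt,
        hφ.eventually_differentiableAt] with u h1 h2
      exact e1 h1 h2 _
    have hf1 := hφ.fderiv_infty.differentiableAt_of_infty.clm_apply (differentiableAt_const v.2.1)
    rw [key.fderiv_eq, fderiv_clm_apply hA.differentiableAt_of_infty hf1]
    simp only [add_apply, ContinuousLinearMap.comp_apply,
      ContinuousLinearMap.flip_apply, fderiv_fderiv_apply hφ]
    have := fderiv_comp v.1 hf.fderiv_infty.differentiableAt_of_infty hφ.differentiableAt_of_infty
    change fderiv ℝ (fun u ↦ fderiv ℝ f (φ u)) v.1 = _ at this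
    rw [this]; rfl
  rw [jet2, e1 hf.differentiableAt_of_infty hφ.differentiableAt_of_infty, e2]
  simp only [jet2, SecondTangentBundle.prolong, map_add, map_smul]
  module

end JetCalculus

/-! ### Vector fields, tensors and Lie derivatives in a chart -/

section ChartCalculus

variable {F : Type*} [NormedAddCommGroup F] [NormedSpace ℝ F]
  {N : Type*} [TopologicalSpace N] [ChartedSpace F N]

/-- The Lie derivative of the bilinear-form-valued map `η` along `ξ` on a vector space. -/
def coordLie (ξ : F → F) (η : F → F →L[ℝ] F →L[ℝ] ℝ) (u a b : F) : ℝ :=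
  fderiv ℝ η u (ξ u) a b + η u (fderiv ℝ ξ u a) b + η u a (fderiv ℝ ξ u b)

/-- The coordinate frame of the preferred chart at `x`, at the point with coordinates `u`. -/
def chartFrame (x : N) (u : F) : F →L[ℝ] TangentSpace 𝓘(ℝ, F) ((chartAt F x).symm u) :=
  mfderiv 𝓘(ℝ, F) 𝓘(ℝ, F) (chartAt F x).symm u

/-- The vector field on `N` with components `ξ` in the preferred chart at `x`. -/
def chartField (x : N) (ξ : F → F) : VField F N :=
  VectorField.mpullback 𝓘(ℝ, F) 𝓘(ℝ, F) (chartAt F x) ξ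

variable [IsManifold 𝓘(ℝ, F) ∞ N]

theorem contMDiffAt_chart_symm (x : N) {u : F} (hu : u ∈ (chartAt F x).target) :
    ContMDiffAt 𝓘(ℝ, F) 𝓘(ℝ, F) ∞ (chartAt F x).symm u :=
  contMDiffAt_symm_of_mem_maximalAtlas (IsManifold.chart_mem_maximalAtlas x) hu

theorem contMDiffAt_chart {x q : N} (hq : q ∈ (chartAt F x).source) :
    ContMDiffAt 𝓘(ℝ, F) 𝓘(ℝ, F) ∞ (chartAt F x) q :=
  contMDiffAt_of_mem_maximalAtlas (IsManifold.chart_mem_maximalAtlas x) hq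

theorem mdifferentiable_chart_infty (x : N) :
    (chartAt F x).MDifferentiable 𝓘(ℝ, F) 𝓘(ℝ, F) :=
  have : IsManifold 𝓘(ℝ, F) 1 N := IsManifold.of_le (n := ∞) (by simp)
  mdifferentiable_chart x

theorem isInvertible_mfderiv_chart {x q : N} (hq : q ∈ (chartAt F x).source) :
    (mfderiv 𝓘(ℝ, F) 𝓘(ℝ, F) (chartAt F x) q).IsInvertible :=
  ⟨(mdifferentiable_chart_infty x).mfderiv hq, rfl⟩

theorem isInvertible_chartFrame (x : N) {u : F} (hu : u ∈ (chartAt F x).target) :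
    (chartFrame x u).IsInvertible :=
  ⟨(mdifferentiable_chart_infty x).symm.mfderiv hu, rfl⟩

theorem chartFrame_localField (X : VField F N) (x : N) {u : F}
    (hu : u ∈ (chartAt F x).target) :
    chartFrame x u (localField X x u) = X ((chartAt F x).symm u) :=
  (isInvertible_chartFrame x hu).self_apply_inverse _

theorem localField_eq_iff {X : VField F N} {x : N} {u : F}
    (hu : u ∈ (chartAt F x).target) {a : F} :
    localField X x u = a ↔
      X ((chartAt F x).symm u) = chartFrame x u a :=
  (isInvertible_chartFrame x hu).inverse_apply_eq

theorem localField_chartField (x : N) (ξ : F → F) {u : F} (hu : u ∈ (chartAt F x).target) :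
    localField (chartField x ξ) x u = ξ u := by
  rw [localField_eq_iff hu]
  have hq := (chartAt F x).map_target hu
  refine (isInvertible_mfderiv_chart hq).inverse_apply_eq.2 ?_
  have := (mdifferentiable_chart_infty x).comp_symm_deriv hu
  rw [(chartAt F x).right_inv hu]
  exact (DFunLike.congr_fun this (ξ u)).symm

theorem chartField_localField (X : VField F N) {x q : N} (hq : q ∈ (chartAt F x).source) :
    chartField x (localField X x) q = X q := by
  refine (isInvertible_mfderiv_chart hq).inverse_apply_eq.2 ?_
  refine (localField_eq_iff ((chartAt F x).map_source hq)).2 ?_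
  rw [(chartAt F x).left_inv hq]
  have := (mdifferentiable_chart_infty x).symm_comp_deriv hq
  exact (DFunLike.congr_fun this (X q)).symm

/-- `localTensor` evaluates h on frame vectors, and the frame turns components back into the field.
-/
theorem localTensor_localField (h : Tensor02 F N) (Y Z : VField F N) (x : N) {u : F}
    (hu : u ∈ (chartAt F x).target) :
    localTensor h x u (localField Y x u) (localField Z x u) =
      h ((chartAt F x).symm u) (Y ((chartAt F x).symm u)) (Z ((chartAt F x).symm u)) := by
  rw [← chartFrame_localField Y x hu, ← chartFrame_localField Z x hu]
  rfl

variable [FiniteDimensional ℝ F]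

theorem contDiffAt_localField {X : VField F N} {U : Set N} (hU : IsOpen U)
    (hX : SmoothFieldOn X U) (x : N) {u : F} (hu : u ∈ (chartAt F x).target)
    (huU : (chartAt F x).symm u ∈ U) : ContDiffAt ℝ ∞ (localField X x) u := by
  have : CompleteSpace F := FiniteDimensional.complete ℝ F
  have h := ContMDiffAt.mpullback_vectorField_preimage (hX.contMDiffAt (hU.mem_nhds huU))
    (contMDiffAt_chart_symm x hu) (isInvertible_chartFrame (F := F) x hu) (by simp)
  exact contMDiffAt_vectorSpace_iff_contDiffAt.1 h

theorem contDiffOn_localField {X : VField F N} (hX : SmoothFieldOn X univ) (x : N) :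
    ContDiffOn ℝ ∞ (localField X x) (chartAt F x).target := fun _ hu ↦
  (contDiffAt_localField isOpen_univ hX x hu (mem_univ _)).contDiffWithinAt

theorem smoothFieldOn_chartField (x : N) {ξ : F → F}
    (hξ : ContDiffOn ℝ ∞ ξ (chartAt F x).target) :
    SmoothFieldOn (chartField x ξ) (chartAt F x).source := by
  have : CompleteSpace F := FiniteDimensional.complete ℝ F
  intro q hq
  have h1 := hξ.contDiffAt ((chartAt F x).open_target.mem_nhds ((chartAt F x).map_source hq))
  exact (ContMDiffAt.mpullback_vectorField_preimage
    (contMDiffAt_vectorSpace_iff_contDiffAt.2 h1) (contMDiffAt_chart hq)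
    (isInvertible_mfderiv_chart hq) (by simp)).contMDiffWithinAt

theorem smoothFieldOn_univ_of_localField {X : VField F N}
    (hX : ∀ x, ContDiffOn ℝ ∞ (localField X x) (chartAt F x).target) : SmoothFieldOn X univ := by
  intro q _
  have hs := (chartAt F q).open_source.mem_nhds (mem_chart_source F q)
  have h := (smoothFieldOn_chartField q (hX q)).contMDiffAt hs
  refine (h.congr_of_eventuallyEq ?_).contMDiffWithinAt
  filter_upwards [hs] with p hp
  rw [chartField_localField X hp]

/-- In coordinates [X, Y] = DY(X) − DX(Y), so the derivatives of Y and Z produced by X(h(Y, Z))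
cancel against those in the brackets. What is left depends only on the values of Y and Z at the
point. -/
theorem lieDerivative_eq_coordLie {X Y Z : VField F N} {h : Tensor02 F N} {U : Set N}
    (hU : IsOpen U) (hX : SmoothFieldOn X univ) (hY : SmoothFieldOn Y U) (hZ : SmoothFieldOn Z U)
    (x : N) {u : F} (hu : u ∈ (chartAt F x).target) (huU : (chartAt F x).symm u ∈ U)
    (hh : ContDiffAt ℝ ∞ (localTensor h x) u) :
    lieDerivative X h Y Z ((chartAt F x).symm u) =
      coordLie (localField X x) (localTensor h x) u (localField Y x u) (localField Z x u) := by
  have : CompleteSpace F := FiniteDimensional.complete ℝ F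
  have hX' := contDiffAt_localField isOpen_univ hX x hu (mem_univ _)
  have hY' := contDiffAt_localField hU hY x hu huU
  have hZ' := contDiffAt_localField hU hZ x hu huU
  have htn := (chartAt F x).open_target.mem_nhds hu
  have hmd {V : VField F N} {W : Set N} (hW : IsOpen W) (hV : SmoothFieldOn V W)
      (hm : (chartAt F x).symm u ∈ W) := (hV.contMDiffAt (hW.mem_nhds hm)).mdifferentiableAt
        (show (∞ : ℕ∞ω) ≠ 0 by simp)
  have hbr (V : VField F N) (hV : SmoothFieldOn V U) :
      VectorField.mlieBracket 𝓘(ℝ, F) X V ((chartAt F x).symm u) =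
        chartFrame x u
          (VectorField.lieBracket ℝ (localField X x) (localField V x) u) := by
    have : IsManifold 𝓘(ℝ, F) (minSmoothness ℝ 3) N := by
      rw [minSmoothness_of_isRCLikeNormedField]
      exact IsManifold.of_le (n := ∞) ENat.LEInfty.out
    have := VectorField.mpullback_mlieBracket (hmd isOpen_univ hX (mem_univ _)) (hmd hU hV huU)
      (contMDiffAt_chart_symm x hu)
      (by rw [minSmoothness_of_isRCLikeNormedField]; exact ENat.LEInfty.out)
    -- Pullback by the inverse chart commutes with brackets; on the model space the manifold bracket
    -- is the usual one.
    refine (localField_eq_iff (X := VectorField.mlieBracket 𝓘(ℝ, F) X V) hu).1 (this.trans ?_)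
    rw [← VectorField.mlieBracketWithin_univ, VectorField.mlieBracketWithin_eq_lieBracketWithin]
    exact congrFun VectorField.lieBracketWithin_univ u
  have hev : (fun w ↦ localTensor h x w (localField Y x w) (localField Z x w)) =ᶠ[𝓝 u]
      (fun p ↦ h p (Y p) (Z p)) ∘ (chartAt F x).symm := by
    filter_upwards [htn] with w hw
    exact localTensor_localField h Y Z x hw
  have hloc : ContDiffAt ℝ ∞
      (fun w ↦ localTensor h x w (localField Y x w) (localField Z x w)) u :=
    (hh.clm_apply hY').clm_apply hZ'
  -- Smoothness of h is known only for its components in this chart, so differentiability of h(Y, Z)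
  -- is carried back through the chart.
  have hmf : MDifferentiableAt 𝓘(ℝ, F) 𝓘(ℝ, ℝ) (fun p ↦ h p (Y p) (Z p))
      ((chartAt F x).symm u) := by
    have h1 : MDifferentiableAt 𝓘(ℝ, F) 𝓘(ℝ, ℝ)
        ((fun w ↦ localTensor h x w (localField Y x w) (localField Z x w)) ∘ chartAt F x)
        ((chartAt F x).symm u) := by
      refine MDifferentiableAt.comp _ ?_
        ((mdifferentiable_chart_infty x).mdifferentiableAt ((chartAt F x).map_target hu))
      rw [(chartAt F x).right_inv hu]
      exact hloc.differentiableAt_of_infty.mdifferentiableAt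
    refine h1.congr_of_eventuallyEq ?_
    filter_upwards [(chartAt F x).open_source.mem_nhds ((chartAt F x).map_target hu)] with p hp
    have := localTensor_localField h Y Z x ((chartAt F x).map_source hp)
    rw [(chartAt F x).left_inv hp] at this
    exact this.symm
  have hD : mfderiv 𝓘(ℝ, F) 𝓘(ℝ, ℝ) (fun p ↦ h p (Y p) (Z p)) ((chartAt F x).symm u)
        (X ((chartAt F x).symm u)) =
      fderiv ℝ (fun w ↦ localTensor h x w (localField Y x w) (localField Z x w)) u
        (localField X x u) := by
    rw [hev.fderiv_eq, ← mfderiv_eq_fderiv, mfderiv_comp u hmf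
      ((mdifferentiable_chart_infty x).mdifferentiableAt_symm hu),
      ← chartFrame_localField X x hu]
    rfl
  have hA (V W : VField F N) (a b : F) : h ((chartAt F x).symm u)
      (chartFrame x u a)
      (chartFrame x u b) = localTensor h x u a b := rfl
  unfold lieDerivative
  simp only
  rw [hD, hbr Y hY, hbr Z hZ, ← chartFrame_localField Y x hu,
    ← chartFrame_localField Z x hu, hA X X, hA X X,
    fderiv_clm_apply (hh.clm_apply hY').differentiableAt_of_infty hZ'.differentiableAt_of_infty,
    fderiv_clm_apply hh.differentiableAt_of_infty hY'.differentiableAt_of_infty]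
  simp only [coordLie, VectorField.lieBracket, add_apply, sub_apply,
    ContinuousLinearMap.comp_apply, ContinuousLinearMap.flip_apply, map_sub]
  ring

theorem lieDerivativeVanishes_iff_coordLie {X : VField F N} {h : Tensor02 F N}
    (hX : SmoothFieldOn X univ)
    (hh : ∀ x, ContDiffOn ℝ ∞ (localTensor h x) (chartAt F x).target) :
    LieDerivativeVanishes X h ↔ ∀ x : N, ∀ u ∈ (chartAt F x).target, ∀ a b : F,
      coordLie (localField X x) (localTensor h x) u a b = 0 := by
  have hh' (x : N) (u : F) (hu : u ∈ (chartAt F x).target) :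
      ContDiffAt ℝ ∞ (localTensor h x) u :=
    (hh x).contDiffAt ((chartAt F x).open_target.mem_nhds hu)
  constructor
  · intro H x u hu a b
    -- Fields with constant components realise arbitrary values `a`, `b`; they are smooth on the
    -- chart domain, an admissible open set in `LieDerivativeVanishes`.
    have hs (d : F) : SmoothFieldOn (chartField x fun _ ↦ d) (chartAt F x).source :=
      smoothFieldOn_chartField x contDiffOn_const
    have hm := (chartAt F x).map_target hu
    have := lieDerivative_eq_coordLie (chartAt F x).open_source hX (hs a) (hs b) x hu hm
      (hh' x u hu)
    rw [localField_chartField x _ hu, localField_chartField x _ hu] at this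
    rw [← this]
    exact H _ (chartAt F x).open_source _ _ (hs a) (hs b) _ hm
  · intro H U hU Y Z hY hZ x hx
    have hu := mem_chart_target F x
    have e := (chartAt F x).left_inv (mem_chart_source F x)
    have := lieDerivative_eq_coordLie hU hX hY hZ x hu (by rwa [e]) (hh' x _ hu)
    rw [e] at this
    rw [this]
    exact H x _ hu _ _

/-- In finite dimension smoothness may be tested on fixed vectors, and the components on `a`, `b`
are the smooth section evaluated on the fields with constant components `a`, `b`. -/
theorem SymmTensor.contDiffOn_localTensor (c : SymmTensor F N) (x : N) :
    ContDiffOn ℝ ∞ (localTensor c.form x) (chartAt F x).target := by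
  rw [contDiffOn_clm_apply]
  intro a
  rw [contDiffOn_clm_apply]
  intro b u hu
  have hq := (chartAt F x).map_target hu
  have hs (d : F) := (smoothFieldOn_chartField x (contDiffOn_const (c := d))).contMDiffAt
    ((chartAt F x).open_source.mem_nhds hq)
  have h1 := (c.contMDiff ((chartAt F x).symm u)).clm_bundle_apply₂
    (E₃ := fun _ : N ↦ ℝ) (hs a) (hs b)
  have h2 : ContMDiffAt 𝓘(ℝ, F) 𝓘(ℝ, ℝ) ∞
      (fun q ↦ c.form q (chartField x (fun _ ↦ a) q) (chartField x (fun _ ↦ b) q))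
      ((chartAt F x).symm u) :=
    (Bundle.contMDiffAt_section _).1 h1
  have h3 := (h2.comp u (contMDiffAt_chart_symm x hu)).contDiffAt
  refine (h3.congr_of_eventuallyEq ?_).contDiffWithinAt
  filter_upwards [(chartAt F x).open_target.mem_nhds hu] with w hw
  have := localTensor_localField c.form (chartField x fun _ ↦ a) (chartField x fun _ ↦ b) x hw
  rw [localField_chartField x _ hw, localField_chartField x _ hw] at this
  exact this

end ChartCalculus

/-! ### The Lie derivative of the deformed metric along the three lifts, in coordinates -/

section LieDerivativeOfLifts

set_option maxSynthPendingDepth 4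

variable {E F G : Type*} [NormedAddCommGroup E] [NormedSpace ℝ E] [NormedAddCommGroup F]
  [NormedSpace ℝ F] [NormedAddCommGroup G] [NormedSpace ℝ G]

open SecondTangentBundle

theorem jet1_add {f g : E → F} {v : E × E × E} (hf : ContDiffAt ℝ ∞ f v.1)
    (hg : ContDiffAt ℝ ∞ g v.1) : jet1 (fun u ↦ f u + g u) v = jet1 f v + jet1 g v := by
  rw [jet1, fderiv_fun_add hf.differentiableAt_of_infty hg.differentiableAt_of_infty]; rfl

theorem jet2_add {f g : E → F} {v : E × E × E} (hf : ContDiffAt ℝ ∞ f v.1)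
    (hg : ContDiffAt ℝ ∞ g v.1) : jet2 (fun u ↦ f u + g u) v = jet2 f v + jet2 g v := by
  have key : fderiv ℝ (fun u ↦ f u + g u) =ᶠ[𝓝 v.1] fun u ↦ fderiv ℝ f u + fderiv ℝ g u := by
    filter_upwards [hf.eventually_differentiableAt, hg.eventually_differentiableAt] with u h1 h2
    exact fderiv_fun_add h1 h2
  rw [jet2, key.fderiv_eq, key.eq_of_nhds,
    fderiv_fun_add hf.fderiv_infty.differentiableAt_of_infty
      hg.fderiv_infty.differentiableAt_of_infty]
  simp only [jet2, add_apply]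
  module

theorem jet1_const (a : F) (v : E × E × E) : jet1 (fun _ ↦ a) v = 0 := by simp [jet1]

theorem jet2_const (a : F) (v : E × E × E) : jet2 (fun _ ↦ a) v = 0 := by
  have : fderiv ℝ (fun _ : E ↦ a) = fun _ ↦ 0 := by ext; simp
  simp [jet2, this]

theorem jet1_apply_const {A : E → F →L[ℝ] G} {v : E × E × E} (hA : ContDiffAt ℝ ∞ A v.1)
    (a : F) : jet1 (fun u ↦ A u a) v = jet1 A v a := by
  rw [jet1_clm_apply hA contDiffAt_const, jet1_const, map_zero, zero_add]

theorem jet2_apply_const {A : E → F →L[ℝ] G} {v : E × E × E} (hA : ContDiffAt ℝ ∞ A v.1)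
    (a : F) : jet2 (fun u ↦ A u a) v = jet2 A v a := by
  rw [jet2_clm_apply hA contDiffAt_const, jet1_const, jet2_const, map_zero, map_zero, zero_add,
    zero_add]

theorem fderiv_prodMk_apply {f : E → F} {g : E → G} {x : E} (hf : DifferentiableAt ℝ f x)
    (hg : DifferentiableAt ℝ g x) (w : E) :
    fderiv ℝ (fun u ↦ (f u, g u)) x w = (fderiv ℝ f x w, fderiv ℝ g x w) := by
  rw [(hf.hasFDerivAt.prodMk hg.hasFDerivAt).fderiv]; rfl

theorem fderiv_prolong_apply {f : E → E} {v : E × E × E} (hf : ContDiffAt ℝ ∞ f v.1)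
    (w : E × E × E) :
    fderiv ℝ (prolong f) v w = (fderiv ℝ f v.1 w.1,
      jet1 (fderiv ℝ f) v w.1 + fderiv ℝ f v.1 w.2.1,
      jet2 (fderiv ℝ f) v w.1 + jet1 (fderiv ℝ f) v w.2.1 + fderiv ℝ f v.1 w.2.2) := by
  have h : ContDiffAt ℝ ∞ (fun v : E × E × E ↦ f v.1) v := hf.comp v contDiffAt_fst
  have h1 := (contDiffAt_jet1 hf).differentiableAt_of_infty
  have h2 := (contDiffAt_jet2 hf).differentiableAt_of_infty
  rw [prolong_eq_jets, fderiv_prodMk_apply h.differentiableAt_of_infty (h1.prodMk h2),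
    fderiv_prodMk_apply h1 h2, fderiv_comp_fst_apply hf, fderiv_jet1_apply hf,
    fderiv_jet2_apply hf]

theorem fderiv_firstLift_apply {f : E → E} {v : E × E × E} (hf : ContDiffAt ℝ ∞ f v.1)
    (w : E × E × E) :
    fderiv ℝ (fun v : E × E × E ↦ ((0 : E), f v.1, jet1 f v)) v w = (0, fderiv ℝ f v.1 w.1,
      jet1 (fderiv ℝ f) v w.1 + fderiv ℝ f v.1 w.2.1) := by
  have h : ContDiffAt ℝ ∞ (fun v : E × E × E ↦ f v.1) v := hf.comp v contDiffAt_fst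
  have h0 := h.differentiableAt_of_infty
  have h1 := (contDiffAt_jet1 hf).differentiableAt_of_infty
  rw [fderiv_prodMk_apply (differentiableAt_const _) (h0.prodMk h1), fderiv_prodMk_apply h0 h1,
    fderiv_comp_fst_apply hf, fderiv_jet1_apply hf]
  simp

theorem fderiv_zerothLift_apply {f : E → E} {v : E × E × E} (hf : ContDiffAt ℝ ∞ f v.1)
    (w : E × E × E) :
    fderiv ℝ (fun v : E × E × E ↦ ((0 : E), (0 : E), f v.1)) v w = (0, 0, fderiv ℝ f v.1 w.1) := by
  have h : ContDiffAt ℝ ∞ (fun v : E × E × E ↦ f v.1) v := hf.comp v contDiffAt_fst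
  have h0 := h.differentiableAt_of_infty
  have hc : DifferentiableAt ℝ (fun _ : E × E × E ↦ (0 : E)) v := differentiableAt_const _
  rw [fderiv_prodMk_apply hc (hc.prodMk h0), fderiv_prodMk_apply hc h0, fderiv_comp_fst_apply hf]
  simp

theorem blockForm_apply (P Q R : E →L[ℝ] E →L[ℝ] ℝ) (w w' : E × E × E) :
    blockForm P Q R w w' = P w.1 w'.1 + Q w.1 w'.2.1 + R w.1 w'.2.2 + Q w.2.1 w'.1 +
      R w.2.1 w'.2.1 + R w.2.2 w'.1 := rfl

/-- The coordinate expression of the deformed second lift metric, for a metric with components `η`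
and a deformation tensor with components `γ`. -/
def coordDeformedLift (η γ : E → E →L[ℝ] E →L[ℝ] ℝ) (v : E × E × E) :
    (E × E × E) →L[ℝ] (E × E × E) →L[ℝ] ℝ :=
  blockForm (jet2 η v + γ v.1) (jet1 η v) (η v.1)

theorem contDiffAt_coordDeformedLift_apply {η γ : E → E →L[ℝ] E →L[ℝ] ℝ}
    {v : E × E × E} (hη : ContDiffAt ℝ ∞ η v.1) (hγ : ContDiffAt ℝ ∞ γ v.1) (w w' : E × E × E) :
    ContDiffAt ℝ ∞ (fun v ↦ coordDeformedLift η γ v w w') v := by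
  have hη0 : ContDiffAt ℝ ∞ (fun v : E × E × E ↦ η v.1) v := hη.comp v contDiffAt_fst
  have hγ0 : ContDiffAt ℝ ∞ (fun v : E × E × E ↦ γ v.1) v := hγ.comp v contDiffAt_fst
  have hη1 := contDiffAt_jet1 hη
  have hP := (contDiffAt_jet2 hη).add hγ0
  have h {A : E × E × E → E →L[ℝ] E →L[ℝ] ℝ} (hA : ContDiffAt ℝ ∞ A v) (a b : E) :
      ContDiffAt ℝ ∞ (fun v ↦ A v a b) v :=
    (hA.clm_apply contDiffAt_const).clm_apply contDiffAt_const
  exact (((((h hP _ _).add (h hη1 _ _)).add (h hη0 _ _)).add (h hη1 _ _)).add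
    (h hη0 _ _)).add (h hη0 _ _)

theorem contDiffOn_coordDeformedLift [FiniteDimensional ℝ E] {η γ : E → E →L[ℝ] E →L[ℝ] ℝ}
    {s : Set E} (hs : IsOpen s) (hη : ContDiffOn ℝ ∞ η s) (hγ : ContDiffOn ℝ ∞ γ s) :
    ContDiffOn ℝ ∞ (coordDeformedLift η γ) (Prod.fst ⁻¹' s) := by
  rw [contDiffOn_clm_apply]
  intro w
  rw [contDiffOn_clm_apply]
  intro w' v hv
  exact (contDiffAt_coordDeformedLift_apply (hη.contDiffAt (hs.mem_nhds hv))
    (hγ.contDiffAt (hs.mem_nhds hv)) w w').contDiffWithinAt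

theorem fderiv_apply_apply {A : F → E →L[ℝ] E →L[ℝ] ℝ} {v : F} (hA : DifferentiableAt ℝ A v)
    (a b : E) (V : F) : fderiv ℝ (fun v ↦ A v a b) v V = fderiv ℝ A v V a b := by
  rw [fderiv_clm_apply (hA.clm_apply (differentiableAt_const a)) (differentiableAt_const b),
    fderiv_clm_apply hA (differentiableAt_const a)]
  simp

/-- `blockForm` is linear in its blocks, so the derivative is taken block by block; fixed test
vectors reduce this to scalar functions. -/
theorem fderiv_coordDeformedLift_apply [FiniteDimensional ℝ E] {η γ : E → E →L[ℝ] E →L[ℝ] ℝ}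
    {s : Set E} (hs : IsOpen s) (hη : ContDiffOn ℝ ∞ η s) (hγ : ContDiffOn ℝ ∞ γ s)
    {v : E × E × E} (hv : v.1 ∈ s) (V : E × E × E) :
    fderiv ℝ (coordDeformedLift η γ) v V =
      blockForm (fderiv ℝ (jet2 η) v V + fderiv ℝ γ v.1 V.1) (fderiv ℝ (jet1 η) v V)
        (fderiv ℝ η v.1 V.1) := by
  have hv' := hs.mem_nhds hv
  have hη' := hη.contDiffAt hv'
  have hγ' := hγ.contDiffAt hv'
  have h := (contDiffOn_coordDeformedLift hs hη hγ).contDiffAt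
    ((hs.preimage continuous_fst).mem_nhds hv)
  have hη0 : DifferentiableAt ℝ (fun v : E × E × E ↦ η v.1) v :=
    (hη'.comp v contDiffAt_fst).differentiableAt_of_infty
  have hγ0 : DifferentiableAt ℝ (fun v : E × E × E ↦ γ v.1) v :=
    (hγ'.comp v contDiffAt_fst).differentiableAt_of_infty
  have hη1 := (contDiffAt_jet1 hη').differentiableAt_of_infty
  have hη2 := (contDiffAt_jet2 hη').differentiableAt_of_infty
  have hP := hη2.fun_add hγ0
  have k {A : E × E × E → E →L[ℝ] E →L[ℝ] ℝ} (hA : DifferentiableAt ℝ A v) (a b : E) :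
      HasFDerivAt (fun v ↦ A v a b) (fderiv ℝ (fun v ↦ A v a b) v) v :=
    ((hA.clm_apply (differentiableAt_const a)).clm_apply (differentiableAt_const b)).hasFDerivAt
  have key (w w' : E × E × E) : fderiv ℝ (coordDeformedLift η γ) v V w w' =
      blockForm (fderiv ℝ (jet2 η) v V + fderiv ℝ γ v.1 V.1) (fderiv ℝ (jet1 η) v V)
        (fderiv ℝ η v.1 V.1) w w' := by
    rw [← fderiv_apply_apply h.differentiableAt_of_infty]
    have := ((((((k hP w.1 w'.1).fun_add (k hη1 w.1 w'.2.1)).fun_add (k hη0 w.1 w'.2.2)).fun_add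
      (k hη1 w.2.1 w'.1)).fun_add (k hη0 w.2.1 w'.2.1)).fun_add (k hη0 w.2.2 w'.1)).fderiv
    change fderiv ℝ (fun v ↦ coordDeformedLift η γ v w w') v = _ at this
    rw [this]
    have hP' : fderiv ℝ (fun v : E × E × E ↦ jet2 η v + γ v.1) v V =
        fderiv ℝ (jet2 η) v V + fderiv ℝ γ v.1 V.1 := by
      rw [fderiv_fun_add hη2 hγ0, add_apply, fderiv_comp_fst_apply hγ']
    rw [blockForm_apply, ← hP', ← fderiv_apply_apply hP]
    simp only [add_apply, fderiv_apply_apply hη1, fderiv_apply_apply hη0,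
      fderiv_comp_fst_apply hη']
  exact ContinuousLinearMap.ext fun w ↦ ContinuousLinearMap.ext fun w' ↦ key w w'

theorem jet1_coordLie {ξ : E → E} {η : E → E →L[ℝ] E →L[ℝ] ℝ} {v : E × E × E}
    (hξ : ContDiffAt ℝ ∞ ξ v.1) (hη : ContDiffAt ℝ ∞ η v.1) (a b : E) :
    jet1 (fun u ↦ coordLie ξ η u a b) v =
      fderiv ℝ η v.1 (jet1 ξ v) a b + jet1 (fderiv ℝ η) v (ξ v.1) a b +
      (η v.1 (jet1 (fderiv ℝ ξ) v a) b + jet1 η v (fderiv ℝ ξ v.1 a) b) +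
      (η v.1 a (jet1 (fderiv ℝ ξ) v b) + jet1 η v a (fderiv ℝ ξ v.1 b)) := by
  have h1 := hξ.fderiv_infty
  have h2 := hη.fderiv_infty
  have ha : ContDiffAt ℝ ∞ (fun _ : E ↦ a) v.1 := contDiffAt_const
  have hb : ContDiffAt ℝ ∞ (fun _ : E ↦ b) v.1 := contDiffAt_const
  have k1 := h2.clm_apply hξ
  have k2 := hη.clm_apply (h1.clm_apply ha)
  have k3 := hη.clm_apply ha
  unfold coordLie
  rw [jet1_add (((k1.clm_apply ha).clm_apply hb).add (k2.clm_apply hb))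
      (k3.clm_apply (h1.clm_apply hb)),
    jet1_add ((k1.clm_apply ha).clm_apply hb) (k2.clm_apply hb),
    jet1_apply_const (k1.clm_apply ha), jet1_apply_const k1, jet1_clm_apply h2 hξ,
    jet1_apply_const k2, jet1_clm_apply hη (h1.clm_apply ha), jet1_apply_const h1,
    jet1_clm_apply k3 (h1.clm_apply hb), jet1_apply_const hη, jet1_apply_const h1]
  simp only [add_apply]

theorem jet2_coordLie {ξ : E → E} {η : E → E →L[ℝ] E →L[ℝ] ℝ} {v : E × E × E}
    (hξ : ContDiffAt ℝ ∞ ξ v.1) (hη : ContDiffAt ℝ ∞ η v.1) (a b : E) :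
    jet2 (fun u ↦ coordLie ξ η u a b) v =
      fderiv ℝ η v.1 (jet2 ξ v) a b + jet1 (fderiv ℝ η) v (jet1 ξ v) a b +
        jet2 (fderiv ℝ η) v (ξ v.1) a b +
      (η v.1 (jet2 (fderiv ℝ ξ) v a) b + jet1 η v (jet1 (fderiv ℝ ξ) v a) b +
        jet2 η v (fderiv ℝ ξ v.1 a) b) +
      (η v.1 a (jet2 (fderiv ℝ ξ) v b) + jet1 η v a (jet1 (fderiv ℝ ξ) v b) +
        jet2 η v a (fderiv ℝ ξ v.1 b)) := by
  have h1 := hξ.fderiv_infty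
  have h2 := hη.fderiv_infty
  have ha : ContDiffAt ℝ ∞ (fun _ : E ↦ a) v.1 := contDiffAt_const
  have hb : ContDiffAt ℝ ∞ (fun _ : E ↦ b) v.1 := contDiffAt_const
  have k1 := h2.clm_apply hξ
  have k2 := hη.clm_apply (h1.clm_apply ha)
  have k3 := hη.clm_apply ha
  unfold coordLie
  rw [jet2_add (((k1.clm_apply ha).clm_apply hb).add (k2.clm_apply hb))
      (k3.clm_apply (h1.clm_apply hb)),
    jet2_add ((k1.clm_apply ha).clm_apply hb) (k2.clm_apply hb),
    jet2_apply_const (k1.clm_apply ha), jet2_apply_const k1, jet2_clm_apply h2 hξ,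
    jet2_apply_const k2, jet2_clm_apply hη (h1.clm_apply ha), jet2_apply_const h1,
    jet1_apply_const h1,
    jet2_clm_apply k3 (h1.clm_apply hb), jet2_apply_const hη, jet1_apply_const hη,
    jet2_apply_const h1, jet1_apply_const h1]
  simp only [add_apply]

theorem jet1_eq_zero_of_eqOn {f : E → F} {s : Set E} {v : E × E × E} (hs : IsOpen s)
    (hv : v.1 ∈ s)
    (hf : ∀ u ∈ s, f u = 0) : jet1 f v = 0 := by
  rw [jet1_congr (g := fun _ ↦ 0) (Filter.eventually_of_mem (hs.mem_nhds hv) hf), jet1_const]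

theorem jet2_eq_zero_of_eqOn {f : E → F} {s : Set E} {v : E × E × E} (hs : IsOpen s)
    (hv : v.1 ∈ s)
    (hf : ∀ u ∈ s, f u = 0) : jet2 f v = 0 := by
  rw [jet2_congr (g := fun _ ↦ 0) (Filter.eventually_of_mem (hs.mem_nhds hv) hf), jet2_const]

section

variable [FiniteDimensional ℝ E] {ξ : E → E} {η γ : E → E →L[ℝ] E →L[ℝ] ℝ} {s : Set E}
  {v : E × E × E}

/-- Moving only z changes only the `jet2 η` block, at the rate Dη(ξ); the two remaining terms of L_X
g come from the pairing of the x- and z-components. -/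
theorem coordLie_zerothLift (hs : IsOpen s) (hξ : ContDiffOn ℝ ∞ ξ s) (hη : ContDiffOn ℝ ∞ η s)
    (hγ : ContDiffOn ℝ ∞ γ s) (hv : v.1 ∈ s) (w w' : E × E × E) :
    coordLie (fun v : E × E × E ↦ ((0 : E), (0 : E), ξ v.1)) (coordDeformedLift η γ) v w w' =
      coordLie ξ η v.1 w.1 w'.1 := by
  have hξ' := hξ.contDiffAt (hs.mem_nhds hv)
  have hη' := hη.contDiffAt (hs.mem_nhds hv)
  rw [coordLie, fderiv_coordDeformedLift_apply hs hη hγ hv, fderiv_zerothLift_apply hξ',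
    fderiv_zerothLift_apply hξ', fderiv_jet1_apply hη', fderiv_jet2_apply hη']
  simp [coordDeformedLift, blockForm_apply, coordLie]

theorem coordLie_firstLift (hs : IsOpen s) (hξ : ContDiffOn ℝ ∞ ξ s) (hη : ContDiffOn ℝ ∞ η s)
    (hγ : ContDiffOn ℝ ∞ γ s) (hv : v.1 ∈ s) (w w' : E × E × E) :
    coordLie (fun v : E × E × E ↦ ((0 : E), ξ v.1, jet1 ξ v)) (coordDeformedLift η γ) v w w' =
      jet1 (fun u ↦ coordLie ξ η u w.1 w'.1) v + coordLie ξ η v.1 w.1 w'.2.1 +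
        coordLie ξ η v.1 w.2.1 w'.1 := by
  have hξ' := hξ.contDiffAt (hs.mem_nhds hv)
  have hη' := hη.contDiffAt (hs.mem_nhds hv)
  rw [coordLie, fderiv_coordDeformedLift_apply hs hη hγ hv, fderiv_firstLift_apply hξ',
    fderiv_firstLift_apply hξ', fderiv_jet1_apply hη', fderiv_jet2_apply hη',
    jet1_coordLie hξ' hη']
  simp only [coordDeformedLift, blockForm_apply, coordLie, add_apply, map_add, map_zero, zero_apply]
  ring

/-- Once all coefficients are expanded by the product rule, the two sides agree term by term. The
extra L_X c arises because the x-component of ᴵᴵX is X itself. -/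
theorem coordLie_secondLift (hs : IsOpen s) (hξ : ContDiffOn ℝ ∞ ξ s) (hη : ContDiffOn ℝ ∞ η s)
    (hγ : ContDiffOn ℝ ∞ γ s) (hv : v.1 ∈ s) (w w' : E × E × E) :
    coordLie (prolong ξ) (coordDeformedLift η γ) v w w' =
      jet2 (fun u ↦ coordLie ξ η u w.1 w'.1) v + jet1 (fun u ↦ coordLie ξ η u w.1 w'.2.1) v +
        jet1 (fun u ↦ coordLie ξ η u w.2.1 w'.1) v + coordLie ξ η v.1 w.1 w'.2.2 +
        coordLie ξ η v.1 w.2.1 w'.2.1 + coordLie ξ η v.1 w.2.2 w'.1 +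
        coordLie ξ γ v.1 w.1 w'.1 := by
  have hξ' := hξ.contDiffAt (hs.mem_nhds hv)
  have hη' := hη.contDiffAt (hs.mem_nhds hv)
  rw [coordLie, fderiv_coordDeformedLift_apply hs hη hγ hv, fderiv_prolong_apply hξ',
    fderiv_prolong_apply hξ', fderiv_jet1_apply hη', fderiv_jet2_apply hη',
    jet1_coordLie hξ' hη', jet1_coordLie hξ' hη', jet2_coordLie hξ' hη', prolong_eq_jets]
  simp only [coordDeformedLift, blockForm_apply, coordLie, add_apply, map_add]
  ring

theorem coordLie_zerothLift_eq_zero_iff (hs : IsOpen s) (hξ : ContDiffOn ℝ ∞ ξ s)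
    (hη : ContDiffOn ℝ ∞ η s) (hγ : ContDiffOn ℝ ∞ γ s) :
    (∀ v ∈ Prod.fst ⁻¹' s, ∀ w w' : E × E × E,
      coordLie (fun v : E × E × E ↦ ((0 : E), (0 : E), ξ v.1)) (coordDeformedLift η γ) v w w' = 0) ↔
      ∀ u ∈ s, ∀ a b, coordLie ξ η u a b = 0 := by
  constructor
  · intro H u hu a b
    have := H (u, 0, 0) hu (a, 0, 0) (b, 0, 0)
    rwa [coordLie_zerothLift hs hξ hη hγ hu] at this
  · intro H v hv w w'
    rw [coordLie_zerothLift hs hξ hη hγ hv, H _ hv]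

theorem coordLie_firstLift_eq_zero_iff (hs : IsOpen s) (hξ : ContDiffOn ℝ ∞ ξ s)
    (hη : ContDiffOn ℝ ∞ η s) (hγ : ContDiffOn ℝ ∞ γ s) :
    (∀ v ∈ Prod.fst ⁻¹' s, ∀ w w' : E × E × E,
      coordLie (fun v : E × E × E ↦ ((0 : E), ξ v.1, jet1 ξ v)) (coordDeformedLift η γ) v w w' =
        0) ↔ ∀ u ∈ s, ∀ a b, coordLie ξ η u a b = 0 := by
  constructor
  · intro H u hu a b
    -- These vectors isolate the xy-block, which is L_X g itself.
    have := H (u, 0, 0) hu (a, 0, 0) (0, b, 0)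
    rw [coordLie_firstLift hs hξ hη hγ hu] at this
    simpa [coordLie, jet1] using this
  · intro H v hv w w'
    rw [coordLie_firstLift hs hξ hη hγ hv, H _ hv, H _ hv,
      jet1_eq_zero_of_eqOn hs hv fun u hu ↦ H u hu _ _]
    simp

theorem coordLie_secondLift_eq_zero_iff (hs : IsOpen s) (hξ : ContDiffOn ℝ ∞ ξ s)
    (hη : ContDiffOn ℝ ∞ η s) (hγ : ContDiffOn ℝ ∞ γ s) :
    (∀ v ∈ Prod.fst ⁻¹' s, ∀ w w' : E × E × E,
      coordLie (prolong ξ) (coordDeformedLift η γ) v w w' = 0) ↔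
      (∀ u ∈ s, ∀ a b, coordLie ξ η u a b = 0) ∧ ∀ u ∈ s, ∀ a b, coordLie ξ γ u a b = 0 := by
  have main {v : E × E × E} (hv : v.1 ∈ s) (w w' : E × E × E)
      (H : ∀ u ∈ s, ∀ a b, coordLie ξ η u a b = 0) :
      coordLie (prolong ξ) (coordDeformedLift η γ) v w w' = coordLie ξ γ v.1 w.1 w'.1 := by
    rw [coordLie_secondLift hs hξ hη hγ hv, H _ hv, H _ hv, H _ hv,
      jet1_eq_zero_of_eqOn hs hv fun u hu ↦ H u hu _ _,
      jet1_eq_zero_of_eqOn hs hv fun u hu ↦ H u hu _ _,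
      jet2_eq_zero_of_eqOn hs hv fun u hu ↦ H u hu _ _]
    simp
  constructor
  · intro H
    have H1 : ∀ u ∈ s, ∀ a b, coordLie ξ η u a b = 0 := by
      intro u hu a b
      -- The xz-block isolates L_X g, without derivatives and without c.
      have := H (u, 0, 0) hu (a, 0, 0) (0, 0, b)
      rw [coordLie_secondLift hs hξ hη hγ hu] at this
      simpa [coordLie, jet1, jet2] using this
    exact ⟨H1, fun u hu a b ↦ (main (v := (u, 0, 0)) hu (a, 0, 0) (b, 0, 0) H1).symm.trans
      (H _ hu _ _)⟩
  · rintro ⟨H1, H2⟩ v hv w w'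
    rw [main hv w w' H1, H2 _ hv]

end

end LieDerivativeOfLifts

/-! ### Changes of chart and the identification of tangent spaces -/

section Transition

variable {F : Type*} [NormedAddCommGroup F]
  {N : Type*} [TopologicalSpace N] [ChartedSpace F N]

/-- The change of coordinates from the preferred chart at `x` to the preferred chart at `x'`. -/
def transition (x x' : N) (u : F) : F := chartAt F x' ((chartAt F x).symm u)

theorem transition_mem_target {x x' : N} {u : F}
    (hu' : (chartAt F x).symm u ∈ (chartAt F x').source) :
    transition x x' u ∈ (chartAt F x').target :=
  (chartAt F x').map_source hu'

theorem chart_symm_transition {x x' : N} {u : F}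
    (hu' : (chartAt F x).symm u ∈ (chartAt F x').source) :
    (chartAt F x').symm (transition x x' u) = (chartAt F x).symm u :=
  (chartAt F x').left_inv hu'

variable [NormedSpace ℝ F] [IsManifold 𝓘(ℝ, F) ∞ N]

theorem contDiffAt_transition {x x' : N} {u : F} (hu : u ∈ (chartAt F x).target)
    (hu' : (chartAt F x).symm u ∈ (chartAt F x').source) :
    ContDiffAt ℝ ∞ (transition x x') u :=
  ((contMDiffAt_chart hu').comp u (contMDiffAt_chart_symm x hu)).contDiffAt

theorem eventually_mem_transition_source {x x' : N} {u : F} (hu : u ∈ (chartAt F x).target)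
    (hu' : (chartAt F x).symm u ∈ (chartAt F x').source) :
    ∀ᶠ w in 𝓝 u, w ∈ (chartAt F x).target ∧ (chartAt F x).symm w ∈ (chartAt F x').source := by
  filter_upwards [(chartAt F x).open_target.mem_nhds hu,
    (contMDiffAt_chart_symm x hu).continuousAt.eventually
      ((chartAt F x').open_source.mem_nhds hu')] with w h1 h2 using ⟨h1, h2⟩

theorem chartFrame_apply_transition {x x' : N} {u : F} (hu : u ∈ (chartAt F x).target)
    (hu' : (chartAt F x).symm u ∈ (chartAt F x').source) (a : F) :
    (chartFrame x' (transition x x' u) (fderiv ℝ (transition x x') u a) : F) =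
      chartFrame x u a := by
  have hev : (chartAt F x').symm ∘ transition x x' =ᶠ[𝓝 u] (chartAt F x).symm := by
    filter_upwards [eventually_mem_transition_source hu hu'] with w hw
    exact chart_symm_transition hw.2
  have h1 : MDifferentiableAt 𝓘(ℝ, F) 𝓘(ℝ, F) (chartAt F x').symm (transition x x' u) :=
    (mdifferentiable_chart_infty x').mdifferentiableAt_symm (transition_mem_target hu')
  have h2 : MDifferentiableAt 𝓘(ℝ, F) 𝓘(ℝ, F) (transition x x') u :=
    (contDiffAt_transition hu hu').differentiableAt_of_infty.mdifferentiableAt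
  have h3 := mfderiv_comp u h1 h2
  rw [hev.mfderiv_eq, mfderiv_eq_fderiv] at h3
  exact (DFunLike.congr_fun h3 a).symm

/-- The normalisation behind all formulas: the tangent space at `q` is the model space, identified
through the preferred chart at `q`, whose frame there is therefore the identity. -/
theorem chartFrame_self_apply (q : N) (a : F) :
    (chartFrame q (chartAt F q q) a : F) = a := by
  have : IsManifold 𝓘(ℝ, F) 1 N := IsManifold.of_le (n := ∞) (by simp)
  have h := mfderivWithin_range_extChartAt_symm (I := 𝓘(ℝ, F)) (x := q)
  rw [modelWithCornersSelf_coe, range_id, mfderivWithin_univ] at h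
  exact DFunLike.congr_fun h a

/-- Chain rule through the preferred chart at `q`, whose own frame at `q` is the identity. -/
theorem chartFrame_eq_fderiv_transition {x q : N} {u : F} (hu : u ∈ (chartAt F x).target)
    (hq : (chartAt F x).symm u = q) (a : F) :
    (chartFrame x u a : F) = fderiv ℝ (transition x q) u a := by
  have hu' : (chartAt F x).symm u ∈ (chartAt F q).source := hq ▸ mem_chart_source F q
  have h := chartFrame_apply_transition hu hu' a
  have e : transition x q u = chartAt F q q := by rw [transition, hq]
  rw [e] at h
  rw [← h]
  exact chartFrame_self_apply q _

theorem fderiv_transition_localField (X : VField F N) {x x' : N} {u : F}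
    (hu : u ∈ (chartAt F x).target)
    (hu' : (chartAt F x).symm u ∈ (chartAt F x').source) :
    fderiv ℝ (transition x x') u (localField X x u) = localField X x' (transition x x' u) := by
  refine ((localField_eq_iff (transition_mem_target hu')).2 ?_).symm
  have h1 := chartFrame_apply_transition hu hu' (localField X x u)
  have h2 : (chartFrame x u (localField X x u) : F) = X ((chartAt F x).symm u) :=
    chartFrame_localField X x hu
  -- Forgetting the dependence of the tangent space on the point makes rewriting the base point
  -- type-correct.
  let X' : N → F := X
  have h3 : X' ((chartAt F x').symm (transition x x' u)) = X' ((chartAt F x).symm u) := by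
    rw [chart_symm_transition hu']
  exact h3.trans (h2.symm.trans h1.symm)

theorem localTensor_transition (h : Tensor02 F N) {x x' : N} {u : F}
    (hu : u ∈ (chartAt F x).target)
    (hu' : (chartAt F x).symm u ∈ (chartAt F x').source) (a b : F) :
    localTensor h x u a b = localTensor h x' (transition x x' u)
      (fderiv ℝ (transition x x') u a) (fderiv ℝ (transition x x') u b) := by
  let h' : N → F →L[ℝ] F →L[ℝ] ℝ := h
  have h1 := chartFrame_apply_transition hu hu' a
  have h2 := chartFrame_apply_transition hu hu' b
  have h3 : h' ((chartAt F x').symm (transition x x' u)) = h' ((chartAt F x).symm u) := by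
    rw [chart_symm_transition hu']
  change h' ((chartAt F x).symm u) (chartFrame x u a) (chartFrame x u b) =
    h' ((chartAt F x').symm (transition x x' u))
      (chartFrame x' (transition x x' u) (fderiv ℝ (transition x x') u a))
      (chartFrame x' (transition x x' u) (fderiv ℝ (transition x x') u b))
  rw [h3]
  exact (congrArg₂ (fun s t : F ↦ h' ((chartAt F x).symm u) s t) h1 h2).symm

end Transition

/-! ### The lifts in a whole induced chart -/

section LocalExpressions

variable {E : Type*} [NormedAddCommGroup E] [NormedSpace ℝ E]
  {M : Type*} [TopologicalSpace M] [ChartedSpace E M]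

open SecondTangentBundle

/-- The transformation law of the jets of a bilinear form under a change of chart. -/
theorem jets_congruence {η η' : E → E →L[ℝ] E →L[ℝ] ℝ} {φ : E → E} {v : E × E × E}
    (hη : ContDiffAt ℝ ∞ η v.1) (hη' : ContDiffAt ℝ ∞ η' (φ v.1)) (hφ : ContDiffAt ℝ ∞ φ v.1)
    (h : ∀ᶠ u in 𝓝 v.1, ∀ a b, η u a b = η' (φ u) (fderiv ℝ φ u a) (fderiv ℝ φ u b)) (a b : E) :
    jet1 η v a b =
        jet1 η' (prolong φ v) (fderiv ℝ φ v.1 a) (fderiv ℝ φ v.1 b) +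
          η' (φ v.1) (jet1 (fderiv ℝ φ) v a) (fderiv ℝ φ v.1 b) +
          η' (φ v.1) (fderiv ℝ φ v.1 a) (jet1 (fderiv ℝ φ) v b) ∧
      jet2 η v a b =
        jet2 η' (prolong φ v) (fderiv ℝ φ v.1 a) (fderiv ℝ φ v.1 b) +
          jet1 η' (prolong φ v) (jet1 (fderiv ℝ φ) v a) (fderiv ℝ φ v.1 b) +
          jet1 η' (prolong φ v) (fderiv ℝ φ v.1 a) (jet1 (fderiv ℝ φ) v b) +
          η' (φ v.1) (jet2 (fderiv ℝ φ) v a) (fderiv ℝ φ v.1 b) +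
          η' (φ v.1) (jet1 (fderiv ℝ φ) v a) (jet1 (fderiv ℝ φ) v b) +
          η' (φ v.1) (fderiv ℝ φ v.1 a) (jet2 (fderiv ℝ φ) v b) := by
  have h1 := hφ.fderiv_infty
  have ha := h1.clm_apply (contDiffAt_const (c := a))
  have hb := h1.clm_apply (contDiffAt_const (c := b))
  have hc : ContDiffAt ℝ ∞ (fun u ↦ η' (φ u)) v.1 := hη'.comp v.1 hφ
  have hη0 := hη.clm_apply (contDiffAt_const (c := a))
  have key : (fun u ↦ η u a b) =ᶠ[𝓝 v.1]
      fun u ↦ η' (φ u) (fderiv ℝ φ u a) (fderiv ℝ φ u b) := by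
    filter_upwards [h] with u hu using hu a b
  constructor
  · rw [← jet1_apply_const hη, ← jet1_apply_const hη0, jet1_congr key,
      jet1_clm_apply (hc.clm_apply ha) hb, jet1_clm_apply hc ha, jet1_comp hη' hφ,
      jet1_apply_const h1, jet1_apply_const h1]
    simp only [add_apply]
    ring
  · rw [← jet2_apply_const hη, ← jet2_apply_const hη0, jet2_congr key,
      jet2_clm_apply (hc.clm_apply ha) hb, jet2_clm_apply hc ha, jet1_clm_apply hc ha,
      jet1_comp hη' hφ, jet2_comp hη' hφ, jet1_apply_const h1, jet1_apply_const h1,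
      jet2_apply_const h1, jet2_apply_const h1]
    simp only [add_apply]
    ring

/-- Covariance of the block matrix under induced coordinate changes: the Jacobian of `prolong φ` has
the Taylor coefficients of Dφ as blocks, and these are the factors in `jets_congruence`. -/
theorem coordDeformedLift_congruence {η η' γ γ' : E → E →L[ℝ] E →L[ℝ] ℝ} {φ : E → E}
    {v : E × E × E} (hη : ContDiffAt ℝ ∞ η v.1) (hη' : ContDiffAt ℝ ∞ η' (φ v.1))
    (hφ : ContDiffAt ℝ ∞ φ v.1)
    (h : ∀ᶠ u in 𝓝 v.1, ∀ a b, η u a b = η' (φ u) (fderiv ℝ φ u a) (fderiv ℝ φ u b))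
    (hγ : ∀ a b, γ v.1 a b = γ' (φ v.1) (fderiv ℝ φ v.1 a) (fderiv ℝ φ v.1 b))
    (w w' : E × E × E) :
    coordDeformedLift η' γ' (prolong φ v) (fderiv ℝ (prolong φ) v w) (fderiv ℝ (prolong φ) v w') =
      coordDeformedLift η γ v w w' := by
  have J := jets_congruence hη hη' hφ h
  rw [fderiv_prolong_apply hφ, fderiv_prolong_apply hφ, coordDeformedLift, coordDeformedLift,
    blockForm_apply, blockForm_apply]
  simp only [add_apply, (J _ _).1, (J _ _).2, h.self_of_nhds, hγ, map_add,
    show (prolong φ v).1 = φ v.1 from rfl]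
  ring

/-- Constant curves suffice. Hence every preferred chart of M is the base of a preferred chart of
T²M. -/
theorem exists_secondTangentBundle_proj_eq (x : M) : ∃ p : SecondTangentBundle E M, p.proj = x :=
  ⟨jet (ContMDiffMap.const x), rfl⟩

theorem coordLie_congr {ξ ξ' : E → E} {η η' : E → E →L[ℝ] E →L[ℝ] ℝ} {s : Set E} {u : E}
    (hs : IsOpen s) (hu : u ∈ s) (hξ : EqOn ξ ξ' s) (hη : EqOn η η' s) (a b : E) :
    coordLie ξ η u a b = coordLie ξ' η' u a b := by
  rw [coordLie, coordLie, (hξ.eventuallyEq_of_mem (hs.mem_nhds hu)).fderiv_eq,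
    (hη.eventuallyEq_of_mem (hs.mem_nhds hu)).fderiv_eq, hξ hu, hη hu]

variable [IsManifold 𝓘(ℝ, E) ∞ M]

theorem proj_chart_symm (p : SecondTangentBundle E M) {v : E × E × E}
    (hv : v.1 ∈ (chartAt E p.proj).target) :
    ((chartAt (E × E × E) p).symm v).proj = (chartAt E p.proj).symm v.1 :=
  proj_inducedChart_symm (chart_mem_atlas E p.proj) hv

theorem chart_symm_mem_source (p : SecondTangentBundle E M) {v : E × E × E}
    (hv : v.1 ∈ (chartAt E p.proj).target) :
    (chartAt E p.proj).symm v.1 ∈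
      (chartAt E ((chartAt (E × E × E) p).symm v).proj).source := by
  rw [← proj_chart_symm p hv]
  exact mem_chart_source E _

theorem transition_secondTangentBundle (p q : SecondTangentBundle E M) {v : E × E × E}
    (hv : v.1 ∈ (chartAt E p.proj).target)
    (hv' : (chartAt E p.proj).symm v.1 ∈ (chartAt E q.proj).source) :
    transition p q v = prolong (transition p.proj q.proj) v :=
  inducedChart_trans_apply (chart_mem_atlas E p.proj) (chart_mem_atlas E q.proj)
    (by simp [hv, hv'])

theorem ownCoords_chart_symm (p : SecondTangentBundle E M) {v : E × E × E}
    (hv : v.1 ∈ (chartAt E p.proj).target) :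
    ownCoords ((chartAt (E × E × E) p).symm v) =
      prolong (transition p.proj ((chartAt (E × E × E) p).symm v).proj) v :=
  transition_secondTangentBundle p _ hv (chart_symm_mem_source p hv)

/-- Transitions of T²M are prolongations of those of M, and the frame is the Jacobian of the
transition to the preferred chart of the point with coordinates `v`; that point stays fixed while
differentiating. -/
theorem chartFrame_secondTangentBundle (p : SecondTangentBundle E M) {v : E × E × E}
    (hv : v.1 ∈ (chartAt E p.proj).target) (w : E × E × E) :
    (chartFrame p v w : E × E × E) =
      fderiv ℝ (prolong (transition p.proj ((chartAt (E × E × E) p).symm v).proj)) v w := by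
  have h : transition p ((chartAt (E × E × E) p).symm v) =ᶠ[𝓝 v]
      prolong (transition p.proj ((chartAt (E × E × E) p).symm v).proj) := by
    have := eventually_mem_transition_source hv (chart_symm_mem_source p hv)
    filter_upwards [continuousAt_fst.eventually this] with v' h'
    exact transition_secondTangentBundle p _ h'.1 h'.2
  rw [← h.fderiv_eq]
  exact chartFrame_eq_fderiv_transition (x := p) hv rfl w

theorem localField_lift0 (X : VField E M) (p : SecondTangentBundle E M)
    {v : E × E × E} (hv : v.1 ∈ (chartAt E p.proj).target) :
    localField (lift0 X) p v = ((0, 0, localField X p.proj v.1) : E × E × E) := by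
  have hs := chart_symm_mem_source p hv
  refine (localField_eq_iff (x := p) hv).2 (Eq.symm ?_)
  refine (chartFrame_secondTangentBundle p hv _).trans ?_
  unfold lift0
  rw [fderiv_prolong_apply (contDiffAt_transition hv hs), ownCoords_chart_symm p hv]
  simp only [prolong_eq_jets, map_zero, zero_add]
  rw [fderiv_transition_localField X hv hs]

theorem deformedLiftMetric_eq {g c : Tensor02 E M}
    (hg : ∀ x, ContDiffOn ℝ ∞ (localTensor g x) (chartAt E x).target)
    (q : SecondTangentBundle E M) :
    deformedLiftMetric g c q =
      coordDeformedLift (localTensor g q.proj) (localTensor c q.proj) (ownCoords q) := by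
  have h : ContDiffAt ℝ ∞ (localTensor g q.proj) (ownCoords q).1 := by
    rw [ownCoords, inducedCoords_fst (chart_mem_atlas E _) (mem_chart_source E _)]
    exact (hg q.proj).contDiffAt ((chartAt E _).open_target.mem_nhds (mem_chart_target E _))
  unfold deformedLiftMetric tensorLift2 tensorLift0
  simp only [fderiv_fderiv_apply h]
  refine ContinuousLinearMap.ext fun (w : E × E × E) ↦
    ContinuousLinearMap.ext fun (w' : E × E × E) ↦ ?_
  change blockForm _ _ _ w w' + blockForm _ _ _ w w' = blockForm _ _ _ w w'
  rw [blockForm_apply, blockForm_apply, blockForm_apply]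
  simp only [jet1, jet2, add_apply, zero_apply]
  ring

/-- The definition uses a different chart at each point of T²M; covariance brings all these
expressions to the one chart at `p`. -/
theorem localTensor_deformedLiftMetric {g c : Tensor02 E M}
    (hg : ∀ x, ContDiffOn ℝ ∞ (localTensor g x) (chartAt E x).target)
    (p : SecondTangentBundle E M) {v : E × E × E} (hv : v.1 ∈ (chartAt E p.proj).target) :
    localTensor (deformedLiftMetric g c) p v =
      coordDeformedLift (localTensor g p.proj) (localTensor c p.proj) v := by
  have hs := chart_symm_mem_source p hv
  have hφ := contDiffAt_transition hv hs
  have hη := (hg p.proj).contDiffAt ((chartAt E _).open_target.mem_nhds hv)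
  have hη' := (hg _).contDiffAt ((chartAt E _).open_target.mem_nhds (transition_mem_target hs))
  refine ContinuousLinearMap.ext fun (w : E × E × E) ↦
    ContinuousLinearMap.ext fun (w' : E × E × E) ↦ ?_
  refine Eq.trans ?_ (coordDeformedLift_congruence hη hη' hφ (by
    filter_upwards [eventually_mem_transition_source hv hs] with u hu a b
    exact localTensor_transition g hu.1 hu.2 a b) (localTensor_transition c hv hs) w w')
  change (deformedLiftMetric g c ((chartAt (E × E × E) p).symm v) :
    (E × E × E) →L[ℝ] (E × E × E) →L[ℝ] ℝ) (chartFrame p v w) (chartFrame p v w') = _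
  rw [chartFrame_secondTangentBundle p hv w, chartFrame_secondTangentBundle p hv w',
    deformedLiftMetric_eq hg, ownCoords_chart_symm p hv]
  rfl

variable [FiniteDimensional ℝ E]

/-- The transformation law of the jets of a vector field under a change of chart. -/
theorem jets_localField_transition {X : VField E M} (hX : SmoothFieldOn X univ) {x x' : M}
    {v : E × E × E} (hv : v.1 ∈ (chartAt E x).target)
    (hv' : (chartAt E x).symm v.1 ∈ (chartAt E x').source) :
    jet1 (localField X x') (prolong (transition x x') v) =
        jet1 (fderiv ℝ (transition x x')) v (localField X x v.1) +
          fderiv ℝ (transition x x') v.1 (jet1 (localField X x) v) ∧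
      jet2 (localField X x') (prolong (transition x x') v) =
        jet2 (fderiv ℝ (transition x x')) v (localField X x v.1) +
          jet1 (fderiv ℝ (transition x x')) v (jet1 (localField X x) v) +
          fderiv ℝ (transition x x') v.1 (jet2 (localField X x) v) := by
  have hφ := contDiffAt_transition hv hv'
  have hξ := contDiffAt_localField isOpen_univ hX x hv (mem_univ _)
  have hξ' := contDiffAt_localField isOpen_univ hX x' (transition_mem_target hv') (mem_univ _)
  have key : (fun u ↦ localField X x' (transition x x' u)) =ᶠ[𝓝 v.1]
      fun u ↦ fderiv ℝ (transition x x') u (localField X x u) := by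
    filter_upwards [eventually_mem_transition_source hv hv'] with u hu
    exact (fderiv_transition_localField X hu.1 hu.2).symm
  constructor
  · rw [← jet1_comp hξ' hφ, jet1_congr key, jet1_clm_apply hφ.fderiv_infty hξ, add_comm]
  · rw [← jet2_comp hξ' hφ, jet2_congr key, jet2_clm_apply hφ.fderiv_infty hξ]
    abel

theorem localField_lift1 {X : VField E M} (hX : SmoothFieldOn X univ)
    (p : SecondTangentBundle E M) {v : E × E × E} (hv : v.1 ∈ (chartAt E p.proj).target) :
    localField (lift1 X) p v =
      ((0, localField X p.proj v.1, jet1 (localField X p.proj) v) : E × E × E) := by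
  have hs := chart_symm_mem_source p hv
  refine (localField_eq_iff (x := p) hv).2 (Eq.symm ?_)
  refine (chartFrame_secondTangentBundle p hv _).trans ?_
  change _ = ((0, localField X _ (ownCoords _).1, jet1 (localField X _) (ownCoords _)) : E × E × E)
  rw [fderiv_prolong_apply (contDiffAt_transition hv hs), ownCoords_chart_symm p hv,
    (jets_localField_transition hX hv hs).1]
  simp only [prolong_eq_jets, map_zero, zero_add]
  rw [fderiv_transition_localField X hv hs]

theorem lift2_eq {X : VField E M} (hX : SmoothFieldOn X univ) (q : SecondTangentBundle E M) :
    lift2 X q = prolong (localField X q.proj) (ownCoords q) := by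
  have h : ContDiffAt ℝ ∞ (localField X q.proj) (ownCoords q).1 := by
    rw [ownCoords, inducedCoords_fst (chart_mem_atlas E _) (mem_chart_source E _)]
    exact contDiffAt_localField isOpen_univ hX _ (mem_chart_target E _) (mem_univ _)
  unfold lift2
  simp only [fderiv_fderiv_apply h]
  rfl

/-- The Jacobian of the prolonged transition sends the Taylor coefficients of the old components of
X to those of the new ones, by `jets_localField_transition`. -/
theorem localField_lift2 {X : VField E M} (hX : SmoothFieldOn X univ)
    (p : SecondTangentBundle E M) {v : E × E × E} (hv : v.1 ∈ (chartAt E p.proj).target) :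
    localField (lift2 X) p v = prolong (localField X p.proj) v := by
  have hs := chart_symm_mem_source p hv
  refine (localField_eq_iff (x := p) hv).2 (Eq.symm ?_)
  refine (chartFrame_secondTangentBundle p hv _).trans ?_
  refine Eq.trans ?_ (lift2_eq hX _).symm
  rw [ownCoords_chart_symm p hv, fderiv_prolong_apply (contDiffAt_transition hv hs),
    prolong_eq_jets (localField X _), prolong_eq_jets (localField X _)]
  simp only
  rw [(jets_localField_transition hX hv hs).1, (jets_localField_transition hX hv hs).2]
  simp only [prolong_eq_jets (transition _ _)]
  rw [fderiv_transition_localField X hv hs]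

section

variable {X : VField E M}

theorem smoothFieldOn_lift0 (hX : SmoothFieldOn X univ) : SmoothFieldOn (lift0 X) univ := by
  refine smoothFieldOn_univ_of_localField fun p ↦ ?_
  have h := contDiffOn_localField hX p.proj
  have h0 : ContDiffOn ℝ ∞ (fun v : E × E × E ↦ localField X p.proj v.1)
      (chartAt (E × E × E) p).target := h.comp contDiffOn_fst fun _ hv ↦ hv
  exact (contDiffOn_const.prodMk (contDiffOn_const.prodMk h0)).congr
    fun v hv ↦ localField_lift0 X p hv

theorem smoothFieldOn_lift1 (hX : SmoothFieldOn X univ) : SmoothFieldOn (lift1 X) univ := by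
  refine smoothFieldOn_univ_of_localField fun p ↦ ?_
  have h := contDiffOn_localField hX p.proj
  have h0 : ContDiffOn ℝ ∞ (fun v : E × E × E ↦ localField X p.proj v.1)
      (chartAt (E × E × E) p).target := h.comp contDiffOn_fst fun _ hv ↦ hv
  have h1 : ContDiffOn ℝ ∞ (jet1 (localField X p.proj)) (chartAt (E × E × E) p).target :=
    fun v hv ↦ (contDiffAt_jet1
      (h.contDiffAt ((chartAt E _).open_target.mem_nhds hv))).contDiffWithinAt
  exact (contDiffOn_const.prodMk (h0.prodMk h1)).congr fun v hv ↦ localField_lift1 hX p hv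

theorem smoothFieldOn_lift2 (hX : SmoothFieldOn X univ) : SmoothFieldOn (lift2 X) univ := by
  refine smoothFieldOn_univ_of_localField fun p ↦ ?_
  exact (contDiffOn_prolong (chartAt E p.proj).open_target (contDiffOn_localField hX p.proj)).congr
    fun v hv ↦ localField_lift2 hX p hv

end

/-- The Lie derivative of the deformed lift metric along a vector field of `T²M` with known
coordinate expressions. -/
theorem lieDerivativeVanishes_deformedLiftMetric_iff {g c : Tensor02 E M}
    (hg : ∀ x, ContDiffOn ℝ ∞ (localTensor g x) (chartAt E x).target)
    (hc : ∀ x, ContDiffOn ℝ ∞ (localTensor c x) (chartAt E x).target)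
    {V : VField (E × E × E) (SecondTangentBundle E M)} (hV : SmoothFieldOn V univ)
    {Λ : M → E × E × E → E × E × E}
    (hΛ : ∀ (p : SecondTangentBundle E M) (v : E × E × E), v.1 ∈ (chartAt E p.proj).target →
      localField V p v = Λ p.proj v) :
    LieDerivativeVanishes V (deformedLiftMetric g c) ↔
      ∀ x : M, ∀ v ∈ Prod.fst ⁻¹' (chartAt E x).target, ∀ w w' : E × E × E,
        coordLie (Λ x) (coordDeformedLift (localTensor g x) (localTensor c x)) v w w' = 0 := by
  have hh (p : SecondTangentBundle E M) :
      ContDiffOn ℝ ∞ (localTensor (deformedLiftMetric g c) p) (chartAt (E × E × E) p).target :=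
    (contDiffOn_coordDeformedLift (chartAt E p.proj).open_target (hg _) (hc _)).congr
      fun v hv ↦ localTensor_deformedLiftMetric hg p hv
  rw [lieDerivativeVanishes_iff_coordLie hV hh]
  have key (p : SecondTangentBundle E M) (v : E × E × E) (hv : v.1 ∈ (chartAt E p.proj).target)
      (w w' : E × E × E) :=
    coordLie_congr (chartAt (E × E × E) p).open_target hv
      (fun v hv ↦ hΛ p v hv) (fun v hv ↦ localTensor_deformedLiftMetric (c := c) hg p hv) w w'
  constructor
  -- The coordinate expressions at `p` depend only on its projection, so any point of T²M over `x`
  -- serves.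
  · intro H x v hv w w'
    obtain ⟨p, rfl⟩ := exists_secondTangentBundle_proj_eq (E := E) x
    rw [← key p v hv]
    exact H p v hv w w'
  · intro H p v hv w w'
    rw [key p v hv]
    exact H p.proj v hv w w'

end LocalExpressions

end

theorem mainTheorem6 {E : Type*} [NormedAddCommGroup E] [NormedSpace ℝ E] [FiniteDimensional ℝ E]
    {M : Type*} [TopologicalSpace M] [ChartedSpace E M] [IsManifold 𝓘(ℝ, E) ∞ M]
    (g : PseudoRiemannianMetric E M) (c : SymmTensor E M)
    (X : VField E M) (hX : SmoothFieldOn X univ) :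
    ((IsKilling (deformedLiftMetric g.form c.form) (lift0 X) ↔ IsKilling g.form X) ∧
      (IsKilling (deformedLiftMetric g.form c.form) (lift1 X) ↔ IsKilling g.form X)) ∧
    (IsKilling (deformedLiftMetric g.form c.form) (lift2 X) ↔
      IsKilling g.form X ∧ LieDerivativeVanishes X c.form) := by
  have hg := g.toSymmTensor.contDiffOn_localTensor
  have hc := c.contDiffOn_localTensor
  have hξ := contDiffOn_localField hX
  have h0 := smoothFieldOn_lift0 hX
  have h1 := smoothFieldOn_lift1 hX
  have h2 := smoothFieldOn_lift2 hX
  -- X and its lifts are smooth, so only the vanishing of Lie derivatives is at stake.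
  simp only [IsKilling, hX, h0, h1, h2, true_and]
  rw [lieDerivativeVanishes_iff_coordLie hX hg, lieDerivativeVanishes_iff_coordLie hX hc,
    lieDerivativeVanishes_deformedLiftMetric_iff hg hc h0
      (Λ := fun x v ↦ (0, 0, localField X x v.1)) fun p v hv ↦ localField_lift0 X p hv,
    lieDerivativeVanishes_deformedLiftMetric_iff hg hc h1
      (Λ := fun x v ↦ (0, localField X x v.1, jet1 (localField X x) v))
      fun p v hv ↦ localField_lift1 hX p hv,
    lieDerivativeVanishes_deformedLiftMetric_iff hg hc h2
      (Λ := fun x ↦ SecondTangentBundle.prolong (localField X x))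
      fun p v hv ↦ localField_lift2 hX p hv,
    ← forall_and]
  -- All conditions are now indexed by the preferred charts of M, and the equivalences hold chart by
  -- chart.
  refine ⟨⟨forall_congr' fun x ↦ ?_, forall_congr' fun x ↦ ?_⟩, forall_congr' fun x ↦ ?_⟩
  · exact coordLie_zerothLift_eq_zero_iff (chartAt E x).open_target (hξ x) (hg x) (hc x)
  · exact coordLie_firstLift_eq_zero_iff (chartAt E x).open_target (hξ x) (hg x) (hc x)
  · exact coordLie_secondLift_eq_zero_iff (chartAt E x).open_target (hξ x) (hg x) (hc x)
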